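/- **Setting.** There are $n$ agents with fair shares $\alpha_1,\dots,\alpha_n>0$, $\sum_j\alpha_j=1$, and $T\ge 2$ rounds with one item each. In round $t$ agent $j$ has a private value $V_j[t]\in[0,1]$ with distribution $\mathcal F_j$, independent across agents and rounds. The *ideal utility* of agent $i$ is $$v_i^*=\sup_\rho \mathbb E_{V\sim\mathcal F_i}[V\rho(V)]\quad\text{over measurable }\rho:[0,\infty)\to[0,1]\text{ with }\mathbb E_{V\sim\mathcal F_i}[\rho(V)]\le\alpha_i .$$ *Competitive Subsidy Mechanism* with payment constant $\bar b$: agent $j$ starts with the budget $B_j[1]=\alpha_jT$. In each round every agent requests to bid or not; requests of agents with $B_j[t]\le 0$ are discarded; the winner is drawn uniformly at random from the set of the remaining (bidding) agents, and nobody wins if this set is empty; if $k$ agents bid, the winner pays $\bar b\,k/(k+1)$, which is deducted from her budget, and nobody else pays. The utility $U_i[t]$ of agent $i$ in round $t$ is $V_i[t]$ if she wins and $0$ otherwise. Agent $i$ uses an *$\alpha_i$-aggressive strategy* if, while her budget is positive, she bids in round $t$ with probability $\rho(V_i[t])$, where $\rho$ attains $v_i^*$ and $\mathbb E_{V\sim\mathcal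 F_i}[\rho(V)]=\alpha_i$ (she bids on the top $\alpha_i$-quantile of her values). The other agents may use arbitrary, possibly randomized and colluding, strategies: their requests in round $t$ may depend on everything that happened before round $t$ and on all their own current values and randomness, but not on agent $i$'s current value and request. A strategy of agent $i$ is *$\lambda$-robust* if $\frac1T\sum_{t=1}^T\mathbb E[U_i[t]]\ge\lambda v_i^*$ whatever the strategies of the other agents. **Theorem.** Fix $n$, $(\alpha_j)_j$ and an agent $i$. 1. For $\bar b=8/3$ there is a constant $C>0$, depending only on $(\alpha_j)_j$ and $i$, such that for all $T\ge2$ and all value distributions every $\alpha_i$-aggressive strategy is $\lambda$-robust with $\lambda=\frac58-C\sqrt{\frac{\log T}{T}}$. 2. For every $\bar b\ge2$ put $$\Lambda=\min\left\{1-\frac{3(1-\alpha_i)}{3\bar b-\alpha_i\bar b},\ \frac{5-\alpha_i}{\bar b(3-\alpha_i)}\right\}.$$ (a) There is a constant $C>0$, depending only on $(\alpha_j)_j$, $i$ and $\bar b$, such that for all $T\ge2$ and all value distributions every $\alpha_i$-aggressive strategy is $\lambda$-robust with $\lambda=\Lambda-C\sqrt{\frac{\log T}{T}}$. (b) There is a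 constant $C>0$, depending only on $(\alpha_j)_j$, $i$, $\bar b$ and $\mathcal F_i$, such that for all $T\ge2$, if agent $i$ uses an $\alpha_i$-aggressive strategy, then, whatever the strategies of the other agents, $$\Pr\left(\frac1T\sum_{t=1}^TU_i[t]\ \ge\ \Big(\Lambda-C\sqrt{\tfrac{\log T}{T}}\Big)v_i^*\right)\ \ge\ 1-\frac{C}{T^2}.$$ -/

import Mathlib

open MeasureTheory ProbabilityTheory

noncomputable section

namespace CompetitiveSubsidy

/-! ### Value distributions and ideal utility -/

/-- `ρ` is a feasible selection rule for the fair share `a` and the value distribution `μ`: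
a measurable map into `[0,1]` whose mean under `μ` is at most `a`. -/
def Feasible (μ : Measure ℝ) (a : ℝ) (ρ : ℝ → ℝ) : Prop :=
  Measurable ρ ∧ (∀ v, ρ v ∈ Set.Icc (0 : ℝ) 1) ∧ ∫ v, ρ v ∂μ ≤ a

/-- The ideal utility: the largest value of `E[V ρ(V)]` over feasible rules `ρ`. -/
def idealUtility (μ : Measure ℝ) (a : ℝ) : ℝ :=
  sSup {x : ℝ | ∃ ρ : ℝ → ℝ, Feasible μ a ρ ∧ x = ∫ v, v * ρ v ∂μ}

/-- `ρ` describes the top `a`-quantile of `μ`: it attains the ideal utility and selects with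
probability exactly `a` (randomizing at the cutoff if necessary). -/
def IsTopQuantileRule (μ : Measure ℝ) (a : ℝ) (ρ : ℝ → ℝ) : Prop :=
  Feasible μ a ρ ∧ ∫ v, ρ v ∂μ = a ∧ ∫ v, v * ρ v ∂μ = idealUtility μ a

/-! ### The randomness of one round and of the whole game -/

/-- The randomness of one round: the value of every agent, a private random seed of every agent
(for randomized strategies), and for every nonempty set `S` of agents the agent that the mechanism
selects if `S` turns out to be the set of bidding agents. -/
abbrev Noise (n : ℕ) : Type :=
  (Fin n → ℝ) × (Fin n → ℝ) × ({S : Finset (Fin n) // S.Nonempty} → Fin n)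

/-- Values are independent with `V_j ∼ F j`, seeds are independent and uniform on `[0,1]`, and
the selection from `S` is uniform on `S`; all these are independent. -/
def noiseLaw {n : ℕ} (F : Fin n → Measure ℝ) : Measure (Noise n) :=
  (Measure.pi F).prod
    ((Measure.pi fun _ : Fin n => (volume : Measure ℝ).restrict (Set.Icc 0 1)).prod
      (Measure.pi fun S : {S : Finset (Fin n) // S.Nonempty} =>
        (PMF.uniformOfFinset S.1 S.2).toMeasure))

instance seedLaw_isProbabilityMeasure :
    IsProbabilityMeasure ((volume : Measure ℝ).restrict (Set.Icc 0 1)) :=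
  ⟨by simp⟩

instance noiseLaw_isProbabilityMeasure {n : ℕ} (F : Fin n → Measure ℝ)
    [∀ j, IsProbabilityMeasure (F j)] : IsProbabilityMeasure (noiseLaw F) := by
  unfold noiseLaw; infer_instance

/-- The law of the randomness of all rounds: independent across rounds. -/
def gameLaw {n : ℕ} (F : Fin n → Measure ℝ) [∀ j, IsProbabilityMeasure (F j)] :
    Measure (ℕ → Noise n) :=
  Measure.infinitePi fun _ : ℕ => noiseLaw F

/-! ### Records, histories and strategies -/

/-- What happened in one round: the values and the seeds of all agents, the indicator of the set
of bidding agents (after the enforcement of budgets), and the indicator of the winner. -/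
abbrev Record (n : ℕ) : Type :=
  (Fin n → ℝ) × (Fin n → ℝ) × (Fin n → Bool) × (Fin n → Bool)

/-- The values in a round. -/
def Record.value {n : ℕ} (R : Record n) (j : Fin n) : ℝ := R.1 j

/-- Whether an agent bids in a round. -/
def Record.bid {n : ℕ} (R : Record n) (j : Fin n) : Bool := R.2.2.1 j

/-- Whether an agent wins a round. -/
def Record.win {n : ℕ} (R : Record n) (j : Fin n) : Bool := R.2.2.2 j

/-- The history of the first `t` rounds. -/
abbrev History (n t : ℕ) : Type := Fin t → Record n

/-- A strategy of a single agent: in round `t` (counted from `0`) she decides whether to request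
to bid, from the history, her current value and her current seed. -/
abbrev Strategy (n : ℕ) : Type := (t : ℕ) → History n t → ℝ → ℝ → Bool

/-- A joint, possibly colluding, strategy of all agents other than `i`: in round `t` their requests
may depend on the whole history and on the current values and seeds of all of them, but not
on the current value and seed of agent `i`. Profiles of individual strategies are special cases. -/
abbrev JointStrategy (n : ℕ) (i : Fin n) : Type :=
  (t : ℕ) → History n t → ({j : Fin n // j ≠ i} → ℝ) → ({j : Fin n // j ≠ i} → ℝ) →
    {j : Fin n // j ≠ i} → Bool

/-- Measurability of a joint strategy, as a function of all that it may depend on. -/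
def JointStrategy.IsMeasurable {n : ℕ} {i : Fin n} (σ : JointStrategy n i) : Prop :=
  ∀ t, Measurable fun p : History n t × ({j : Fin n // j ≠ i} → ℝ) × ({j : Fin n // j ≠ i} → ℝ) =>
    σ t p.1 p.2.1 p.2.2

/-- The strategy that requests to bid with probability `ρ(v)` when the current value is `v`. (An
agent without budget is kept from bidding by the mechanism.) -/
def quantileStrategy {n : ℕ} (ρ : ℝ → ℝ) : Strategy n :=
  fun _ _ v u => decide (u < ρ v)

/-- `π` is an `a`-aggressive strategy for an agent with value distribution `μ`. -/
def IsAggressive {n : ℕ} (μ : Measure ℝ) (a : ℝ) (π : Strategy n) : Prop :=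
  ∃ ρ : ℝ → ℝ, IsTopQuantileRule μ a ρ ∧ π = quantileStrategy ρ

/-! ### The mechanism -/

/-- The payment of agent `j` in a round: if `k` agents bid, the winner pays `b * k / (k + 1)`
and nobody else pays. -/
def payment {n : ℕ} (b : ℝ) (R : Record n) (j : Fin n) : ℝ :=
  let k : ℝ := ((Finset.univ.filter fun l => R.bid l = true).card : ℝ)
  if R.win j = true then b * (k / (1 + k)) else 0

/-- The remaining budget of agent `j` after a history: the endowment `α j * T` minus all payments
made so far. -/
def budget {n : ℕ} (α : Fin n → ℝ) (T : ℕ) (b : ℝ) {t : ℕ} (h : History n t) (j : Fin n) : ℝ :=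
  α j * T - ∑ s, payment b (h s) j

/-- The requests in a round, when agent `i` plays `π` and the other agents play `σ`. -/
def request {n : ℕ} {i : Fin n} (π : Strategy n) (σ : JointStrategy n i) {t : ℕ}
    (h : History n t) (x : Noise n) (j : Fin n) : Bool :=
  if hj : j = i then π t h (x.1 i) (x.2.1 i)
  else σ t h (fun l => x.1 l) (fun l => x.2.1 l) ⟨j, hj⟩

/-- The set of bidding agents: those who request to bid and have positive budget. -/
def bidders {n : ℕ} (α : Fin n → ℝ) (T : ℕ) (b : ℝ) {i : Fin n} (π : Strategy n)
    (σ : JointStrategy n i) {t : ℕ} (h : History n t) (x : Noise n) : Finset (Fin n) :=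
  Finset.univ.filter fun j => request π σ h x j = true ∧ 0 < budget α T b h j

/-- One round of the mechanism after the history `h`, with randomness `x`. If nobody bids, nobody
wins. -/
def playRound {n : ℕ} (α : Fin n → ℝ) (T : ℕ) (b : ℝ) {i : Fin n} (π : Strategy n)
    (σ : JointStrategy n i) {t : ℕ} (h : History n t) (x : Noise n) : Record n :=
  let S := bidders α T b π σ h x
  (x.1, x.2.1, fun j => decide (j ∈ S),
    fun j => if hS : S.Nonempty then decide (x.2.2 ⟨S, hS⟩ = j) else false)

/-- The history of the first `t` rounds of the mechanism. -/
def history {n : ℕ} (α : Fin n → ℝ) (T : ℕ) (b : ℝ) {i : Fin n} (π : Strategy n)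
    (σ : JointStrategy n i) (ω : ℕ → Noise n) : (t : ℕ) → History n t
  | 0 => Fin.elim0
  | t + 1 => Fin.snoc (α := fun _ => Record n) (history α T b π σ ω t)
      (playRound α T b π σ (history α T b π σ ω t) (ω t))

/-- The utility of agent `i` in round `t < T`: her value if she wins, and `0` otherwise. -/
def utility {n : ℕ} (α : Fin n → ℝ) (T : ℕ) (b : ℝ) {i : Fin n} (π : Strategy n)
    (σ : JointStrategy n i) (t : Fin T) (ω : ℕ → Noise n) : ℝ :=
  let R : Record n := history α T b π σ ω T t
  if R.win i = true then R.value i else 0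

/-- The strategy `π` of agent `i` is `lam`-robust in the mechanism with `T` rounds and payment
constant `b`. -/
def IsRobust {n : ℕ} (α : Fin n → ℝ) (T : ℕ) (b : ℝ) (F : Fin n → Measure ℝ)
    [∀ j, IsProbabilityMeasure (F j)] (i : Fin n) (π : Strategy n) (lam : ℝ) : Prop :=
  ∀ σ : JointStrategy n i, σ.IsMeasurable →
    lam * idealUtility (F i) (α i) ≤
      (1 / (T : ℝ)) * ∑ t : Fin T, ∫ ω, utility α T b π σ t ω ∂(gameLaw F)

/-- The rate `√(log T / T)`. -/
def rate (T : ℕ) : ℝ := Real.sqrt (Real.log T / T)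

/-- The robustness factor for fair share `a` and payment constant `b`. -/
def robustFactor (a b : ℝ) : ℝ :=
  min (1 - 3 * (1 - a) / (3 * b - a * b)) ((5 - a) / (b * (3 - a)))

end CompetitiveSubsidy

end

/-! Fix the history of a round in which agent `i` has budget, and let `m` be the number of bidding
rivals. The rivals do not see the current value and seed of agent `i`, so these and the selection of
the winner can be averaged out with `m` fixed. Put `a = α i`. Agent `i` bids with probability `a`
and, when bidding, wins with probability `1/(m+1)`. Her mean payment is therefore `a*b/(m+2)`, her
mean utility is `v*/(m+1)`, and the mean payment of the rivals is `rivalRate a b m`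
(`integral_agentLaw_win`, `integral_agentLaw_bid`). The deviations from these means are bounded
martingale differences, so by Azuma–Hoeffding each sum of them exceeds a multiple of `√(T log T)`
with probability at most `1/T^2`. Conditioning is expressed by resampling: replacing the noise of
one round by an independent copy preserves the law and leaves the history before that round
unchanged.

It remains to bound `∑ 1/(m+1)` over the rounds in which agent `i` has budget
(`robustFactor_mul_sub_le`). The rivals together spend at most `(1-a)T + O(1)`, which bounds the sum
of `rivalRate`. If agent `i` never runs out of budget, then `1/(m+1) ≥ 1 - 3/(b(3-a)) * rivalRate a
b m` is summed over all `T` rounds and gives the first term of `robustFactor`. If she runs out, she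
has spent `aT`, so `∑ 1/(m+2)` is at least about `T/b`, and `1/(m+1) ≥ 2/(m+2) - 1/(b(3-a)) *
rivalRate a b m` gives the second term. Both inequalities are tight at `m = 0` and `m = 1`.

In expectation the utility deviation vanishes exactly, so the constant does not depend on the value
distributions. With high probability that deviation is an additive error, and dividing it by `v*`
makes the constant depend on the distribution of agent `i`. -/

noncomputable section

namespace CompetitiveSubsidy

/-! ### Resampling coordinates of product measures -/

/-- Replacing one coordinate of an infinite product by an independent copy preserves the law. -/
theorem measurePreserving_update_infinitePi {ι : Type*} [DecidableEq ι] {X : ι → Type*}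
    [∀ i, MeasurableSpace (X i)] (μ : ∀ i, Measure (X i)) [∀ i, IsProbabilityMeasure (μ i)]
    (i : ι) :
    MeasurePreserving (fun p : (∀ j, X j) × X i => Function.update p.1 i p.2)
      ((Measure.infinitePi μ).prod (μ i)) (Measure.infinitePi μ) := by
  have hm : Measurable (fun p : (∀ j, X j) × X i => Function.update p.1 i p.2) := by
    refine measurable_pi_iff.2 fun j => ?_
    by_cases h : j = i
    · subst h
      simpa using measurable_snd
    · simp only [Function.update_of_ne h]
      exact (measurable_pi_apply j).comp measurable_fst
  refine ⟨hm, Measure.eq_infinitePi _ fun s t ht => ?_⟩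
  rw [Measure.map_apply hm (MeasurableSet.pi s.countable_toSet fun j _ => ht j)]
  -- On a cylinder constraining coordinate `i`, the fresh copy supplies that factor and the old
  -- coordinate becomes free; otherwise the fresh copy is free.
  by_cases hi : i ∈ s
  · have hpre : (fun p : (∀ j, X j) × X i => Function.update p.1 i p.2) ⁻¹' (Set.pi s t) =
        (Set.pi (s.erase i : Finset ι) t) ×ˢ t i := by
      ext ⟨x, y⟩
      simp only [Set.mem_preimage, Set.mem_pi, Finset.mem_coe, Set.mem_prod, Finset.mem_erase]
      constructor
      · intro h
        refine ⟨fun j hj => ?_, ?_⟩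
        · simpa [Function.update_of_ne hj.1] using h j hj.2
        · simpa using h i hi
      · rintro ⟨h1, h2⟩ j hj
        by_cases hji : j = i
        · subst hji; simpa using h2
        · simpa [Function.update_of_ne hji] using h1 j ⟨hji, hj⟩
    rw [hpre, Measure.prod_prod, Measure.infinitePi_pi _ fun j _ => ht j, mul_comm,
      Finset.mul_prod_erase s (fun j => μ j (t j)) hi]
  · have hpre : (fun p : (∀ j, X j) × X i => Function.update p.1 i p.2) ⁻¹' (Set.pi s t) =
        (Set.pi s t) ×ˢ Set.univ := by
      ext ⟨x, y⟩
      simp only [Set.mem_preimage, Set.mem_pi, Finset.mem_coe, Set.mem_prod, Set.mem_univ,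
        and_true]
      refine forall₂_congr fun j hj => ?_
      rw [Function.update_of_ne (ne_of_mem_of_not_mem hj hi)]
    rw [hpre, Measure.prod_prod, Measure.infinitePi_pi _ fun j _ => ht j, measure_univ, mul_one]

/-- Replacing one coordinate of a finite product by an independent copy preserves the law. -/
theorem measurePreserving_update_pi {ι : Type*} [Fintype ι] [DecidableEq ι] {X : ι → Type*}
    [∀ i, MeasurableSpace (X i)] (μ : ∀ i, Measure (X i)) [∀ i, IsProbabilityMeasure (μ i)]
    (i : ι) :
    MeasurePreserving (fun p : (∀ j, X j) × X i => Function.update p.1 i p.2)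
      ((Measure.pi μ).prod (μ i)) (Measure.pi μ) := by
  rw [← Measure.infinitePi_eq_pi]
  exact measurePreserving_update_infinitePi μ i

/-- Exchanging the two middle factors of a product of four measures preserves the law. -/
theorem measurePreserving_prod_prod_comm {A B C D : Type*} [MeasurableSpace A]
    [MeasurableSpace B] [MeasurableSpace C] [MeasurableSpace D] (μ : Measure A) (ν : Measure B)
    (κ : Measure C) (τ : Measure D) [SFinite μ] [SFinite ν] [SFinite κ] [SFinite τ] :
    MeasurePreserving (fun p : (A × B) × (C × D) => ((p.1.1, p.2.1), (p.1.2, p.2.2)))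
      ((μ.prod ν).prod (κ.prod τ)) ((μ.prod κ).prod (ν.prod τ)) := by
  have h1 := measurePreserving_prodAssoc μ ν (κ.prod τ)
  have h2 : MeasurePreserving (fun p : B × (C × D) => (p.2.1, (p.1, p.2.2)))
      (ν.prod (κ.prod τ)) (κ.prod (ν.prod τ)) :=
    (measurePreserving_prodAssoc κ ν τ).comp
      ((Measure.measurePreserving_swap.prod (MeasurePreserving.id τ)).comp
        ((measurePreserving_prodAssoc ν κ τ).symm))
  have h3 := (measurePreserving_prodAssoc μ κ (ν.prod τ)).symm
  exact h3.comp (((MeasurePreserving.id μ).prod h2).comp h1)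

/-- Two resampling maps combine to a resampling map on the product. -/
theorem measurePreserving_prod_resample {A B C D : Type*} [MeasurableSpace A]
    [MeasurableSpace B] [MeasurableSpace C] [MeasurableSpace D] {μ : Measure A} {ν : Measure B}
    {κ : Measure C} {τ : Measure D} [SFinite μ] [SFinite ν] [SFinite κ] [SFinite τ]
    {f : A × C → A} {g : B × D → B} (hf : MeasurePreserving f (μ.prod κ) μ)
    (hg : MeasurePreserving g (ν.prod τ) ν) :
    MeasurePreserving (fun p : (A × B) × (C × D) => (f (p.1.1, p.2.1), g (p.1.2, p.2.2)))
      ((μ.prod ν).prod (κ.prod τ)) (μ.prod ν) :=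
  (hf.prod hg).comp (measurePreserving_prod_prod_comm μ ν κ τ)

/-! ### The Azuma–Hoeffding inequality for resampled increments -/

/-- Azuma–Hoeffding: let the increments `D t` be bounded and such that resampling the randomness
of step `t` leaves the earlier increments unchanged and makes `D t` centred. Then their sums are
sub-Gaussian. -/
theorem hasSubgaussianMGF_sum_of_resample {Ω Y : Type*} [MeasurableSpace Ω] [MeasurableSpace Y]
    {P : Measure Ω} [IsProbabilityMeasure P] {κ : Measure Y} [IsProbabilityMeasure κ]
    {Φ : ℕ → Ω × Y → Ω} (hΦ : ∀ t, MeasurePreserving (Φ t) (P.prod κ) P)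
    {D : ℕ → Ω → ℝ} (hD : ∀ t, Measurable (D t)) {c : NNReal}
    (hb : ∀ t ω, ∀ᵐ y ∂κ, |D t (Φ t (ω, y))| ≤ c)
    (hadapt : ∀ s t, s < t → ∀ ω y, D s (Φ t (ω, y)) = D s ω)
    (hmean : ∀ t ω, ∫ y, D t (Φ t (ω, y)) ∂κ = 0) (T : ℕ) :
    HasSubgaussianMGF (fun ω => ∑ t ∈ Finset.range T, D t ω) (T * c ^ 2) P := by
  -- The bound is assumed only after resampling; it transfers to `P` because resampling preserves
  -- the law.
  have hae : ∀ᵐ ω ∂P, ∀ t, |D t ω| ≤ c := by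
    refine ae_all_iff.2 fun t => ?_
    have hms : MeasurableSet {ω | |D t ω| ≤ c} := measurableSet_le (hD t).abs measurable_const
    have h1 : ∀ᵐ p ∂(P.prod κ), |D t (Φ t p)| ≤ c := by
      exact (Measure.ae_prod_iff_ae_ae ((hΦ t).measurable hms)).2
        (Filter.Eventually.of_forall (hb t))
    have h2 : ∀ᵐ ω ∂(Measure.map (Φ t) (P.prod κ)), |D t ω| ≤ c :=
      (ae_map_iff (hΦ t).measurable.aemeasurable hms).2 h1
    rwa [(hΦ t).map_eq] at h2
  have hS : ∀ T, Measurable fun ω => ∑ t ∈ Finset.range T, D t ω := fun T =>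
    Finset.measurable_sum _ fun t _ => hD t
  have hint : ∀ T (l : ℝ),
      Integrable (fun ω => Real.exp (l * ∑ t ∈ Finset.range T, D t ω)) P := by
    intro T l
    refine Integrable.of_bound (C := Real.exp (|l| * (T * c)))
      ((hS T).const_mul l).exp.aestronglyMeasurable ?_
    filter_upwards [hae] with ω hω
    rw [Real.norm_eq_abs, Real.abs_exp, Real.exp_le_exp]
    refine (le_abs_self _).trans ?_
    rw [abs_mul]
    refine mul_le_mul_of_nonneg_left ?_ (abs_nonneg l)
    refine (Finset.abs_sum_le_sum_abs _ _).trans ?_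
    simpa using Finset.sum_le_sum fun t (_ : t ∈ Finset.range T) => hω t
  refine ⟨fun l => hint T l, fun l => ?_⟩
  have key : ∀ T : ℕ, ∫ ω, Real.exp (l * ∑ t ∈ Finset.range T, D t ω) ∂P ≤
      Real.exp (c ^ 2 * l ^ 2 / 2) ^ T := by
    intro T
    induction T with
    | zero => simp
    | succ T ih =>
      have hm := hΦ T
      have hinc : ∀ ω, ∫ y, Real.exp (l * D T (Φ T (ω, y))) ∂κ ≤
          Real.exp (c ^ 2 * l ^ 2 / 2) := by
        intro ω
        have hmeas : Measurable fun y => D T (Φ T (ω, y)) :=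
          (hD T).comp (hm.measurable.comp measurable_prodMk_left)
        have hI : ∀ᵐ y ∂κ, D T (Φ T (ω, y)) ∈ Set.Icc (-c : ℝ) c := by
          filter_upwards [hb T ω] with y hy using abs_le.1 hy
        have h := (hasSubgaussianMGF_of_mem_Icc_of_integral_eq_zero hmeas.aemeasurable hI
          (hmean T ω)).mgf_le l
        refine h.trans (Real.exp_le_exp.2 (le_of_eq ?_))
        -- Hoeffding's lemma gives the square of half the interval length as variance parameter,
        -- here `c ^ 2`.
        have : ‖(c : ℝ) - -c‖₊ = 2 * c := by
          apply NNReal.eq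
          push_cast
          rw [Real.norm_eq_abs, abs_of_nonneg (by have := c.2; linarith [c.coe_nonneg])]
          ring
        rw [this]
        push_cast
        ring
      have hi := hint (T + 1) l
      -- Resampling step `T` does not affect the earlier increments, so the exponential splits into
      -- a factor free of `y` and the last increment.
      have hexp : ∀ p : Ω × Y, Real.exp (l * ∑ t ∈ Finset.range (T + 1), D t (Φ T p)) =
          Real.exp (l * ∑ t ∈ Finset.range T, D t p.1) * Real.exp (l * D T (Φ T p)) := by
        intro p
        rw [← Real.exp_add, Finset.sum_range_succ, mul_add]
        congr 3
        exact Finset.sum_congr rfl fun t ht => hadapt t T (Finset.mem_range.1 ht) p.1 p.2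
      have hi' : Integrable (fun p : Ω × Y => Real.exp (l * ∑ t ∈ Finset.range T, D t p.1) *
          Real.exp (l * D T (Φ T p))) (P.prod κ) := by
        have := hm.integrable_comp_of_integrable hi
        exact this.congr (Filter.Eventually.of_forall hexp)
      calc ∫ ω, Real.exp (l * ∑ t ∈ Finset.range (T + 1), D t ω) ∂P
          = ∫ p, Real.exp (l * ∑ t ∈ Finset.range (T + 1), D t (Φ T p)) ∂(P.prod κ) := by
            conv_lhs => rw [← hm.map_eq]
            exact integral_map hm.measurable.aemeasurable
              ((hS (T + 1)).const_mul l).exp.aestronglyMeasurable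
        _ = ∫ ω, ∫ y, Real.exp (l * ∑ t ∈ Finset.range T, D t ω) *
              Real.exp (l * D T (Φ T (ω, y))) ∂κ ∂P := by
            simp_rw [hexp]
            exact integral_prod _ hi'
        _ ≤ ∫ ω, Real.exp (l * ∑ t ∈ Finset.range T, D t ω) *
              Real.exp (c ^ 2 * l ^ 2 / 2) ∂P := by
            refine integral_mono hi'.integral_prod_left ((hint T l).mul_const _) fun ω => ?_
            simp only [integral_const_mul]
            exact mul_le_mul_of_nonneg_left (hinc ω) (Real.exp_pos _).le
        _ ≤ Real.exp (c ^ 2 * l ^ 2 / 2) ^ (T + 1) := by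
            rw [integral_mul_const, pow_succ]
            exact mul_le_mul_of_nonneg_right ih (Real.exp_pos _).le
  refine (key T).trans (le_of_eq ?_)
  rw [← Real.exp_nat_mul]
  push_cast
  ring_nf

/-- The integral against a resampled law is an iterated integral. -/
theorem integral_eq_integral_resample {Ω Y : Type*} [MeasurableSpace Ω] [MeasurableSpace Y]
    {P : Measure Ω} [IsProbabilityMeasure P] {κ : Measure Y} [IsProbabilityMeasure κ]
    {Φ : Ω × Y → Ω} (hΦ : MeasurePreserving Φ (P.prod κ) P) {f : Ω → ℝ} (hf : Integrable f P) :
    ∫ ω, f ω ∂P = ∫ ω, ∫ y, f (Φ (ω, y)) ∂κ ∂P := by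
  have h1 := integral_map hΦ.measurable.aemeasurable
    (f := f) (by rw [hΦ.map_eq]; exact hf.aestronglyMeasurable)
  rw [hΦ.map_eq] at h1
  exact h1.trans (integral_prod _ (hΦ.integrable_comp_of_integrable hf))

/-! ### Measurability of the game -/

theorem measurable_payment {n : ℕ} (b : ℝ) (j : Fin n) :
    Measurable fun R : Record n => payment b R j :=
  (Measurable.of_discrete (f := fun q : (Fin n → Bool) × (Fin n → Bool) =>
    payment b ((0, 0, q) : Record n) j)).comp measurable_snd.snd

theorem measurable_budget {n : ℕ} (α : Fin n → ℝ) (T : ℕ) (b : ℝ) (t : ℕ) (j : Fin n) :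
    Measurable fun h : History n t => budget α T b h j := by
  unfold budget
  refine measurable_const.sub (Finset.measurable_sum _ fun s _ => ?_)
  exact (measurable_payment b j).comp (measurable_pi_apply s)

section

variable {n : ℕ} {i : Fin n} (α : Fin n → ℝ) (T : ℕ) (b : ℝ) {ρ : ℝ → ℝ}
  {σ : JointStrategy n i}

theorem measurableSet_mem_bidders (hρ : Measurable ρ) (hσ : σ.IsMeasurable) (t : ℕ) (j : Fin n) :
    MeasurableSet {p : History n t × Noise n |
      j ∈ bidders α T b (quantileStrategy ρ) σ p.1 p.2} := by
  have hB : MeasurableSet {p : History n t × Noise n | 0 < budget α T b p.1 j} :=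
    measurableSet_lt measurable_const ((measurable_budget α T b t j).comp measurable_fst)
  have hR : MeasurableSet {p : History n t × Noise n |
      request (quantileStrategy ρ) σ p.1 p.2 j = true} := by
    by_cases hj : j = i
    · simp only [request, hj, dif_pos, quantileStrategy, decide_eq_true_eq]
      exact measurableSet_lt (by fun_prop) (by fun_prop)
    · simp only [request, hj, dif_neg, not_false_eq_true]
      have hm : Measurable fun p : History n t × Noise n =>
          σ t p.1 (fun l => p.2.1 l) (fun l => p.2.2.1 l) ⟨j, hj⟩ := by
        refine (measurable_pi_apply (⟨j, hj⟩ : {j : Fin n // j ≠ i})).comp ?_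
        have hg : Measurable fun p : History n t × Noise n =>
            (p.1, (fun l : {j : Fin n // j ≠ i} => p.2.1 l),
              (fun l : {j : Fin n // j ≠ i} => p.2.2.1 l)) := by fun_prop
        exact (hσ t).comp hg
      exact hm (measurableSet_singleton true)
  convert hR.inter hB using 1
  ext p
  simp [bidders]

theorem measurableSet_bidders_eq (hρ : Measurable ρ) (hσ : σ.IsMeasurable) (t : ℕ)
    (S : Finset (Fin n)) :
    MeasurableSet {p : History n t × Noise n |
      bidders α T b (quantileStrategy ρ) σ p.1 p.2 = S} := by
  have : {p : History n t × Noise n | bidders α T b (quantileStrategy ρ) σ p.1 p.2 = S} =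
      ⋂ j : Fin n, {p | j ∈ bidders α T b (quantileStrategy ρ) σ p.1 p.2 ↔ j ∈ S} := by
    ext p
    simp [Finset.ext_iff]
  rw [this]
  refine MeasurableSet.iInter fun j => ?_
  have h := measurableSet_mem_bidders α T b hρ hσ t j
  by_cases hj : j ∈ S
  · simpa [hj] using h
  · simp only [hj, iff_false]
    exact h.compl

/-- A function of the bidding set and of the noise is measurable if it is so for each bidding
set. -/
theorem measurable_of_bidders {β : Type*} [MeasurableSpace β] (hρ : Measurable ρ)
    (hσ : σ.IsMeasurable) (t : ℕ) {f : Finset (Fin n) → History n t × Noise n → β}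
    (hf : ∀ S, Measurable (f S)) :
    Measurable fun p : History n t × Noise n =>
      f (bidders α T b (quantileStrategy ρ) σ p.1 p.2) p := by
  intro A hA
  have : (fun p : History n t × Noise n =>
      f (bidders α T b (quantileStrategy ρ) σ p.1 p.2) p) ⁻¹' A =
      ⋃ S : Finset (Fin n), {p | bidders α T b (quantileStrategy ρ) σ p.1 p.2 = S} ∩
        f S ⁻¹' A := by
    ext p
    simp
  rw [this]
  exact MeasurableSet.iUnion fun S =>
    (measurableSet_bidders_eq α T b hρ hσ t S).inter (hf S hA)

theorem measurable_playRound (hρ : Measurable ρ) (hσ : σ.IsMeasurable) (t : ℕ) :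
    Measurable fun p : History n t × Noise n =>
      playRound α T b (quantileStrategy ρ) σ p.1 p.2 := by
  refine measurable_of_bidders α T b hρ hσ t (f := fun S p =>
    ((p.2.1, p.2.2.1, fun j => decide (j ∈ S),
      fun j => if hS : S.Nonempty then decide (p.2.2.2 ⟨S, hS⟩ = j) else false) : Record n))
    fun S => ?_
  refine Measurable.prodMk (by fun_prop) (Measurable.prodMk (by fun_prop)
    (Measurable.prodMk measurable_const (measurable_pi_iff.2 fun j => ?_)))
  by_cases hS : S.Nonempty
  · simp only [hS, dif_pos]
    exact (Measurable.of_discrete (f := fun k : Fin n => decide (k = j))).comp (by fun_prop)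
  · simp only [hS, dif_neg, not_false_eq_true]
    exact measurable_const

theorem measurable_history (hρ : Measurable ρ) (hσ : σ.IsMeasurable) (t : ℕ) :
    Measurable fun ω : ℕ → Noise n => history α T b (quantileStrategy ρ) σ ω t := by
  induction t with
  | zero => exact measurable_pi_iff.2 fun s => s.elim0
  | succ t ih =>
    refine measurable_pi_iff.2 fun s => ?_
    simp only [history]
    refine Fin.lastCases ?_ (fun s => ?_) s
    · simp only [Fin.snoc_last]
      exact (measurable_playRound α T b hρ hσ t).comp (ih.prodMk (measurable_pi_apply t))
    · simp only [Fin.snoc_castSucc]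
      exact (measurable_pi_apply s).comp ih

end

/-! ### The evolution of histories and budgets -/

section

variable {n : ℕ} {i : Fin n} (α : Fin n → ℝ) (T : ℕ) (b : ℝ) (π : Strategy n)
  (σ : JointStrategy n i)

theorem history_congr {ω ω' : ℕ → Noise n} {t : ℕ} (h : ∀ s < t, ω s = ω' s) :
    history α T b π σ ω t = history α T b π σ ω' t := by
  induction t with
  | zero => rfl
  | succ t ih =>
    simp only [history]
    rw [ih fun s hs => h s (hs.trans t.lt_succ_self), h t t.lt_succ_self]

/-- The history at time `s` uses only the noise of rounds before `s`. The case `s = t` allows the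
noise of round `t` to be averaged with its history fixed. -/
theorem history_update (ω : ℕ → Noise n) (x : Noise n) {s t : ℕ} (h : s ≤ t) :
    history α T b π σ (Function.update ω t x) s = history α T b π σ ω s :=
  history_congr α T b π σ fun _ hr => Function.update_of_ne (hr.trans_le h).ne _ _

theorem history_apply (ω : ℕ → Noise n) {m : ℕ} (t : Fin m) :
    history α T b π σ ω m t = playRound α T b π σ (history α T b π σ ω t) (ω t) := by
  induction m with
  | zero => exact t.elim0
  | succ m ih =>
    refine Fin.lastCases ?_ (fun s => ?_) t
    · simp [history]
    · simp only [history, Fin.snoc_castSucc, ih, Fin.val_castSucc]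

theorem budget_history (ω : ℕ → Noise n) (t : ℕ) (j : Fin n) :
    budget α T b (history α T b π σ ω t) j = α j * T - ∑ s ∈ Finset.range t,
      payment b (playRound α T b π σ (history α T b π σ ω s) (ω s)) j := by
  unfold budget
  simp only [history_apply]
  rw [Finset.sum_range]

end

/-! ### Resampling one agent within a round -/

/-- The law of the selection of the winner. -/
abbrev selectionLaw (n : ℕ) : Measure ({S : Finset (Fin n) // S.Nonempty} → Fin n) :=
  Measure.pi fun S : {S : Finset (Fin n) // S.Nonempty} =>
    (PMF.uniformOfFinset S.1 S.2).toMeasure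

/-- The law of the value and the seed of one agent, together with the selection of the winner. -/
def agentLaw {n : ℕ} (μ : Measure ℝ) :
    Measure (ℝ × ℝ × ({S : Finset (Fin n) // S.Nonempty} → Fin n)) :=
  μ.prod (((volume : Measure ℝ).restrict (Set.Icc 0 1)).prod (selectionLaw n))

instance agentLaw_isProbabilityMeasure {n : ℕ} (μ : Measure ℝ) [IsProbabilityMeasure μ] :
    IsProbabilityMeasure (agentLaw (n := n) μ) := by
  unfold agentLaw; infer_instance

/-- Replace the value and the seed of agent `i` and the selection of the winner. -/
def resampleAgent {n : ℕ} (i : Fin n)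
    (p : Noise n × (ℝ × ℝ × ({S : Finset (Fin n) // S.Nonempty} → Fin n))) : Noise n :=
  (Function.update p.1.1 i p.2.1, Function.update p.1.2.1 i p.2.2.1, p.2.2.2)

theorem measurePreserving_resampleAgent {n : ℕ} (F : Fin n → Measure ℝ)
    [∀ j, IsProbabilityMeasure (F j)] (i : Fin n) :
    MeasurePreserving (resampleAgent i) ((noiseLaw F).prod (agentLaw (F i))) (noiseLaw F) :=
  measurePreserving_prod_resample (measurePreserving_update_pi F i)
    (measurePreserving_prod_resample
      (measurePreserving_update_pi
        (fun _ : Fin n => (volume : Measure ℝ).restrict (Set.Icc 0 1)) i)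
      -- The selection is replaced as a whole, so its resampling map is just the second projection.
      measurePreserving_snd)

section

variable {n : ℕ} {i : Fin n} (α : Fin n → ℝ) (T : ℕ) (b : ℝ)

/-- The bidding agents other than agent `i`. -/
def rivals (π : Strategy n) (σ : JointStrategy n i) {t : ℕ} (h : History n t) (x : Noise n) :
    Finset (Fin n) :=
  (bidders α T b π σ h x).erase i

variable {α T b} {ρ : ℝ → ℝ} {σ : JointStrategy n i} {t : ℕ} {h : History n t}

theorem mem_bidders_self {x : Noise n} :
    i ∈ bidders α T b (quantileStrategy ρ) σ h x ↔
      x.2.1 i < ρ (x.1 i) ∧ 0 < budget α T b h i := by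
  rw [bidders, Finset.mem_filter]
  simp [request, quantileStrategy]

/-- This is where the information constraint enters: the requests of the rivals see neither the
current value nor the current seed of agent `i`, and budgets are read off the history. -/
theorem rivals_resampleAgent (π : Strategy n) (x : Noise n)
    (y : ℝ × ℝ × ({S : Finset (Fin n) // S.Nonempty} → Fin n)) :
    rivals α T b π σ h (resampleAgent i (x, y)) = rivals α T b π σ h x := by
  ext j
  simp only [rivals, Finset.mem_erase, bidders, Finset.mem_filter, Finset.mem_univ, true_and]
  refine and_congr_right fun hj => ?_
  have h1 : (fun l : {j : Fin n // j ≠ i} => (resampleAgent i (x, y)).1 l) =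
      fun l : {j : Fin n // j ≠ i} => x.1 l :=
    funext fun l => Function.update_of_ne l.2 _ _
  have h2 : (fun l : {j : Fin n // j ≠ i} => (resampleAgent i (x, y)).2.1 l) =
      fun l : {j : Fin n // j ≠ i} => x.2.1 l :=
    funext fun l => Function.update_of_ne l.2 _ _
  simp only [request, hj, dif_neg, not_false_eq_true]
  rw [h1, h2]

theorem card_bidders (hB : 0 < budget α T b h i) (x : Noise n) :
    (bidders α T b (quantileStrategy ρ) σ h x).card =
      (rivals α T b (quantileStrategy ρ) σ h x).card + if x.2.1 i < ρ (x.1 i) then 1 else 0 := by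
  unfold rivals
  split_ifs with hx
  · rw [Finset.card_erase_add_one (mem_bidders_self.2 ⟨hx, hB⟩)]
  · rw [Finset.erase_eq_of_notMem fun hi => hx (mem_bidders_self.1 hi).1, add_zero]

end

/-- A fixed member of a nonempty set `S` is selected from `S` with probability `1 / |S|`. -/
theorem integral_selection {n : ℕ} (S : Finset (Fin n)) (hS : S.Nonempty) (i : Fin n) (c : ℝ) :
    ∫ w, (if w ⟨S, hS⟩ = i then c else 0) ∂(selectionLaw n) = if i ∈ S then c / S.card else 0 := by
  have h1 := (measurePreserving_eval (fun S : {S : Finset (Fin n) // S.Nonempty} =>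
        (PMF.uniformOfFinset S.1 S.2).toMeasure) ⟨S, hS⟩)
  have h2 := integral_map (μ := selectionLaw n) h1.measurable.aemeasurable
    (f := fun k : Fin n => if k = i then c else 0)
    (Measurable.of_discrete).aestronglyMeasurable
  rw [h1.map_eq] at h2
  refine h2.symm.trans ?_
  rw [PMF.integral_eq_sum]
  simp only [smul_eq_mul, mul_ite, mul_zero, Finset.sum_ite_eq', Finset.mem_univ, if_true]
  split_ifs with hi
  · simp [PMF.uniformOfFinset_apply_of_mem hS hi, div_eq_inv_mul]
  · simp [PMF.uniformOfFinset_apply_of_notMem hS hi]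

/-! ### Expectations within one round -/

/-- Turns the comparison of a uniform seed with `ρ v` into bidding with probability `ρ v`. -/
theorem integral_uniform_lt {r : ℝ} (hr : r ∈ Set.Icc (0 : ℝ) 1) (A B : ℝ) :
    ∫ u in Set.Icc (0 : ℝ) 1, (if u < r then A else B) = r * A + (1 - r) * B := by
  have h1 : ∀ u : ℝ, (if u < r then A else B) = B + (Set.Iio r).indicator (fun _ => A - B) u := by
    intro u
    by_cases hu : u < r <;> simp [Set.indicator, hu]
  simp_rw [h1]
  rw [integral_add (integrable_const _) ((integrable_const _).indicator measurableSet_Iio),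
    integral_indicator measurableSet_Iio, Measure.restrict_restrict measurableSet_Iio]
  have h2 : Set.Iio r ∩ Set.Icc (0 : ℝ) 1 = Set.Ico 0 r := by
    ext u
    simp only [Set.mem_inter_iff, Set.mem_Iio, Set.mem_Icc, Set.mem_Ico]
    constructor
    · rintro ⟨h, h', -⟩; exact ⟨h', h⟩
    · rintro ⟨h, h'⟩; exact ⟨h', h, h'.le.trans hr.2⟩
  rw [h2]
  simp [hr.1]
  ring

theorem ae_mem_of_apply_eq_one {μ : Measure ℝ} [IsProbabilityMeasure μ]
    (hμ : μ (Set.Icc 0 1) = 1) : ∀ᵐ v ∂μ, v ∈ Set.Icc (0 : ℝ) 1 :=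
  (prob_compl_eq_zero_iff measurableSet_Icc).2 hμ

section

variable {n : ℕ} {i : Fin n} {α : Fin n → ℝ} {T : ℕ} {b : ℝ} {ρ : ℝ → ℝ}
  {σ : JointStrategy n i} {t : ℕ}

theorem integral_agentLaw_bid (μ : Measure ℝ) [IsProbabilityMeasure μ] (hρ : Measurable ρ)
    (hρ01 : ∀ v, ρ v ∈ Set.Icc (0 : ℝ) 1) (A B : ℝ) :
    ∫ y, (if y.2.1 < ρ y.1 then A else B) ∂(agentLaw (n := n) μ) =
      (∫ v, ρ v ∂μ) * A + (1 - ∫ v, ρ v ∂μ) * B := by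
  have hint : Integrable (fun y : ℝ × ℝ × ({S : Finset (Fin n) // S.Nonempty} → Fin n) =>
      if y.2.1 < ρ y.1 then A else B) (agentLaw μ) := by
    refine Integrable.of_bound (C := max |A| |B|) ?_ (Filter.Eventually.of_forall fun y => ?_)
    · exact (Measurable.ite (measurableSet_lt (by fun_prop) (by fun_prop)) measurable_const
        measurable_const).aestronglyMeasurable
    · simp only [Real.norm_eq_abs]
      split_ifs
      exacts [le_max_left _ _, le_max_right _ _]
  have hρi : Integrable ρ μ := Integrable.of_bound (C := 1) hρ.aestronglyMeasurable
    (Filter.Eventually.of_forall fun v => by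
      rw [Real.norm_eq_abs, abs_of_nonneg (hρ01 v).1]; exact (hρ01 v).2)
  unfold agentLaw at hint ⊢
  rw [integral_prod _ hint]
  have : ∀ v, ∫ z, (if z.1 < ρ v then A else B)
      ∂(((volume : Measure ℝ).restrict (Set.Icc 0 1)).prod (selectionLaw n)) =
      ρ v * (A - B) + B := by
    intro v
    rw [integral_fun_fst (μ := (volume : Measure ℝ).restrict (Set.Icc 0 1))
      (fun u => if u < ρ v then A else B), integral_uniform_lt (hρ01 v)]
    simp
    ring
  simp_rw [this]
  rw [integral_add (hρi.mul_const _) (integrable_const _), integral_mul_const]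
  simp
  ring

theorem win_playRound {π : Strategy n} {h : History n t} {x : Noise n} :
    (playRound α T b π σ h x).win i = true ↔
      ∃ hS : (bidders α T b π σ h x).Nonempty, x.2.2 ⟨_, hS⟩ = i := by
  by_cases hS : (bidders α T b π σ h x).Nonempty <;> simp [playRound, Record.win, hS]

theorem payment_playRound {π : Strategy n} {h : History n t} {x : Noise n} (j : Fin n) :
    payment b (playRound α T b π σ h x) j =
      if (playRound α T b π σ h x).win j = true then
        b * ((bidders α T b π σ h x).card / (1 + (bidders α T b π σ h x).card)) else 0 := by
  have : (Finset.univ.filter fun l => (playRound α T b π σ h x).bid l = true) =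
      bidders α T b π σ h x := by
    ext l
    simp [playRound, Record.bid]
  simp only [payment, this]

/-- The expectation of a reward that agent `i` gets on winning, averaged over her own value, her
seed and the selection of the winner. -/
theorem integral_agentLaw_win {μ : Measure ℝ} [IsProbabilityMeasure μ] (hρ : Measurable ρ)
    (hρ01 : ∀ v, ρ v ∈ Set.Icc (0 : ℝ) 1) (hσ : σ.IsMeasurable) {h : History n t}
    (hB : 0 < budget α T b h i) (x : Noise n) {f : ℝ → ℕ → ℝ} (hf : ∀ k, Measurable (f · k))
    {c : ℝ} (hc : ∀ᵐ v ∂μ, ∀ k, |f v k| ≤ c) :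
    Integrable (fun y => if (playRound α T b (quantileStrategy ρ) σ h
        (resampleAgent i (x, y))).win i = true then
      f y.1 (bidders α T b (quantileStrategy ρ) σ h (resampleAgent i (x, y))).card else 0)
      (agentLaw μ) ∧
    ∫ y, (if (playRound α T b (quantileStrategy ρ) σ h (resampleAgent i (x, y))).win i = true then
      f y.1 (bidders α T b (quantileStrategy ρ) σ h (resampleAgent i (x, y))).card else 0)
      ∂(agentLaw μ) =
    (∫ v, ρ v * f v ((rivals α T b (quantileStrategy ρ) σ h x).card + 1) ∂μ) /
      ((rivals α T b (quantileStrategy ρ) σ h x).card + 1) := by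
  set m := (rivals α T b (quantileStrategy ρ) σ h x).card with hm
  have hres : Measurable fun y : ℝ × ℝ × ({S : Finset (Fin n) // S.Nonempty} → Fin n) =>
      (h, resampleAgent i (x, y)) := by
    unfold resampleAgent
    exact measurable_const.prodMk (by fun_prop)
  have hmeas : Measurable fun y : ℝ × ℝ × ({S : Finset (Fin n) // S.Nonempty} → Fin n) =>
      if (playRound α T b (quantileStrategy ρ) σ h (resampleAgent i (x, y))).win i = true then
      f y.1 (bidders α T b (quantileStrategy ρ) σ h (resampleAgent i (x, y))).card else 0 := by
    have h1 := measurable_of_bidders (i := i) α T b hρ hσ t (f := fun S p => f (p.2.1 i) S.card)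
      (fun S => (hf S.card).comp (by fun_prop))
    have h2 := (measurable_playRound (i := i) α T b hρ hσ t).comp hres
    refine Measurable.ite ?_ ?_ measurable_const
    · have h3 : Measurable fun R : Record n => R.win i := by unfold Record.win; fun_prop
      exact (h3.comp h2) (measurableSet_singleton true)
    · have := h1.comp hres
      simpa [Function.comp_def, resampleAgent] using this
  have hint := Integrable.of_bound (μ := agentLaw (n := n) μ) (C := c)
      hmeas.aestronglyMeasurable <| by
    have h1 : ∀ᵐ y ∂(agentLaw (n := n) μ), ∀ k, |f y.1 k| ≤ c :=
      Measure.quasiMeasurePreserving_fst.ae hc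
    filter_upwards [h1] with y hy
    rw [Real.norm_eq_abs]
    split_ifs
    · exact hy _
    · simpa using (abs_nonneg _).trans (hy 0)
  refine ⟨hint, ?_⟩
  unfold agentLaw at hint ⊢
  rw [integral_prod _ hint, ← integral_div]
  refine integral_congr_ae ?_
  filter_upwards [hint.prod_right_ae] with v hv
  rw [integral_prod _ hv]
  have hin : ∀ u, ∫ w, (if (playRound α T b (quantileStrategy ρ) σ h
        (resampleAgent i (x, v, u, w))).win i = true then
      f v (bidders α T b (quantileStrategy ρ) σ h (resampleAgent i (x, v, u, w))).card else 0)
      ∂(selectionLaw n) = if u < ρ v then f v (m + 1) / (m + 1) else 0 := by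
    intro u
    set X : ({S : Finset (Fin n) // S.Nonempty} → Fin n) → Noise n := fun w =>
      resampleAgent i (x, v, u, w) with hX
    change ∫ w, (if (playRound α T b (quantileStrategy ρ) σ h (X w)).win i = true then
      f v (bidders α T b (quantileStrategy ρ) σ h (X w)).card else 0) ∂(selectionLaw n) = _
    -- Some selection `w₀` is fixed only to name the bidding set, which does not depend on the
    -- selection.
    rcases isEmpty_or_nonempty ({S : Finset (Fin n) // S.Nonempty} → Fin n) with he | ⟨⟨w₀⟩⟩
    · exact (he.false fun _ => i).elim
    set S := bidders α T b (quantileStrategy ρ) σ h (X w₀) with hS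
    have hSw : ∀ w, bidders α T b (quantileStrategy ρ) σ h (X w) = S := fun w => rfl
    have hmem : i ∈ S ↔ u < ρ v := by
      rw [hS, mem_bidders_self]
      simp [hX, resampleAgent, hB]
    have hcard : S.card = m + if u < ρ v then 1 else 0 := by
      rw [hS, card_bidders hB, rivals_resampleAgent]
      simp [hX, resampleAgent, hm]
    by_cases hne : S.Nonempty
    · have h1 : ∀ w, (if (playRound α T b (quantileStrategy ρ) σ h (X w)).win i = true then
          f v (bidders α T b (quantileStrategy ρ) σ h (X w)).card else 0) =
          if w ⟨S, hne⟩ = i then f v S.card else 0 := by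
        intro w
        have h2 : (playRound α T b (quantileStrategy ρ) σ h (X w)).win i = true ↔
            w ⟨S, hne⟩ = i := by
          rw [win_playRound]
          exact ⟨fun ⟨_, hw⟩ => hw, fun hw => ⟨hne, hw⟩⟩
        simp only [h2, hSw]
      simp only [h1, integral_selection S hne, hmem]
      split_ifs with hu
      · rw [if_pos hu] at hcard
        rw [hcard]
        push_cast
        rfl
      · rfl
    · have h1 : ∀ w, ¬ (playRound α T b (quantileStrategy ρ) σ h (X w)).win i = true := by
        intro w hw
        obtain ⟨h2, -⟩ := win_playRound.1 hw
        exact hne h2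
      have h2 : ¬ u < ρ v := fun hu => hne ⟨i, hmem.2 hu⟩
      simp [h1, h2]
  simp only [hin]
  rw [integral_uniform_lt (hρ01 v)]
  ring

end

/-! ### Centred increments -/

/-- A family of bounded functions of the history and of the current noise that are centred given
the history. -/
structure IsCentredIncrement {n : ℕ} (ν : Measure (Noise n)) (c : NNReal)
    (d : ∀ t, History n t → Noise n → ℝ) : Prop where
  measurable : ∀ t, Measurable fun p : History n t × Noise n => d t p.1 p.2
  bounded : ∀ t h, ∀ᵐ x ∂ν, |d t h x| ≤ c
  centred : ∀ t h, ∫ x, d t h x ∂ν = 0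

theorem IsCentredIncrement.neg {n : ℕ} {ν : Measure (Noise n)} {c : NNReal}
    {d : ∀ t, History n t → Noise n → ℝ} (hd : IsCentredIncrement ν c d) :
    IsCentredIncrement ν c fun t h x => -d t h x where
  measurable t := (hd.measurable t).neg
  bounded t h := by simpa using hd.bounded t h
  centred t h := by rw [integral_neg, hd.centred, neg_zero]

/-- It suffices to be centred for each fixed noise of the rivals, after averaging only over the
value and seed of agent `i` and the selection. This is why collusion does no harm. -/
theorem IsCentredIncrement.of_resampleAgent {n : ℕ} (F : Fin n → Measure ℝ)
    [∀ j, IsProbabilityMeasure (F j)] (i : Fin n) {c : NNReal}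
    {d : ∀ t, History n t → Noise n → ℝ}
    (hm : ∀ t, Measurable fun p : History n t × Noise n => d t p.1 p.2)
    (hb : ∀ t h, ∀ᵐ x ∂(noiseLaw F), |d t h x| ≤ c)
    (hc : ∀ t h x, ∫ y, d t h (resampleAgent i (x, y)) ∂(agentLaw (F i)) = 0) :
    IsCentredIncrement (noiseLaw F) c d where
  measurable := hm
  bounded := hb
  centred t h := by
    rw [integral_eq_integral_resample (f := d t h) (measurePreserving_resampleAgent F i)
      (Integrable.of_bound (C := c) ((hm t).comp measurable_prodMk_left).aestronglyMeasurable
        (hb t h))]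
    simp [hc]

section

variable {n : ℕ} {i : Fin n} (α : Fin n → ℝ) (T : ℕ) (b : ℝ) {ρ : ℝ → ℝ}
  {σ : JointStrategy n i} {F : Fin n → Measure ℝ} [∀ j, IsProbabilityMeasure (F j)]
  {c : NNReal} {d : ∀ t, History n t → Noise n → ℝ}

theorem measurable_comp_history (hρ : Measurable ρ) (hσ : σ.IsMeasurable) {t : ℕ}
    {f : History n t → Noise n → ℝ} (hf : Measurable fun p : History n t × Noise n => f p.1 p.2) :
    Measurable fun ω : ℕ → Noise n => f (history α T b (quantileStrategy ρ) σ ω t) (ω t) :=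
  hf.comp ((measurable_history α T b hρ hσ t).prodMk (measurable_pi_apply t))

/-- Resampling the noise of one round. -/
theorem measurePreserving_update_gameLaw (F : Fin n → Measure ℝ)
    [∀ j, IsProbabilityMeasure (F j)] (t : ℕ) :
    MeasurePreserving (fun p : (ℕ → Noise n) × Noise n => Function.update p.1 t p.2)
      ((gameLaw F).prod (noiseLaw F)) (gameLaw F) :=
  measurePreserving_update_infinitePi (fun _ : ℕ => noiseLaw F) t

instance gameLaw_isProbabilityMeasure (F : Fin n → Measure ℝ)
    [∀ j, IsProbabilityMeasure (F j)] : IsProbabilityMeasure (gameLaw F) := by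
  unfold gameLaw; infer_instance

theorem IsCentredIncrement.hasSubgaussianMGF (hd : IsCentredIncrement (noiseLaw F) c d)
    (hρ : Measurable ρ) (hσ : σ.IsMeasurable) (m : ℕ) :
    HasSubgaussianMGF (fun ω : ℕ → Noise n => ∑ t ∈ Finset.range m,
      d t (history α T b (quantileStrategy ρ) σ ω t) (ω t)) (m * c ^ 2) (gameLaw F) := by
  refine hasSubgaussianMGF_sum_of_resample (measurePreserving_update_gameLaw F)
    (fun t => measurable_comp_history α T b hρ hσ (hd.measurable t)) (fun t ω => ?_) (fun s t hst ω y => ?_)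
    (fun t ω => ?_) m
  · simpa [history_update] using hd.bounded t _
  · simp only [history_update _ _ _ _ _ ω y hst.le, Function.update_of_ne hst.ne]
  · simpa [history_update] using hd.centred t _

theorem IsCentredIncrement.measureReal_sum_ge_le (hd : IsCentredIncrement (noiseLaw F) c d)
    (hρ : Measurable ρ) (hσ : σ.IsMeasurable) (m : ℕ) {ε : ℝ} (hε : 0 ≤ ε) :
    (gameLaw F).real {ω : ℕ → Noise n | ε ≤ ∑ t ∈ Finset.range m,
      d t (history α T b (quantileStrategy ρ) σ ω t) (ω t)} ≤
      Real.exp (-ε ^ 2 / (2 * (m * c ^ 2))) := by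
  simpa using (hd.hasSubgaussianMGF α T b hρ hσ m).measure_ge_le hε

theorem IsCentredIncrement.integral_history (hd : IsCentredIncrement (noiseLaw F) c d) (t : ℕ)
    (hi : Integrable (fun ω : ℕ → Noise n =>
      d t (history α T b (quantileStrategy ρ) σ ω t) (ω t)) (gameLaw F)) :
    ∫ ω, d t (history α T b (quantileStrategy ρ) σ ω t) (ω t) ∂(gameLaw F) = 0 := by
  rw [integral_eq_integral_resample (measurePreserving_update_gameLaw F t) hi]
  simp [history_update, hd.centred]

end

/-! ### The deviations of payments and utility from their conditional means -/

/-- The expected payment of the rivals in a round in which `m` of them bid. -/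
def rivalRate (a b : ℝ) (m : ℕ) : ℝ := b * m * (a / (m + 2) + (1 - a) / (m + 1))

section

variable {n : ℕ} {i : Fin n} (α : Fin n → ℝ) (T : ℕ) (b : ℝ) (ρ : ℝ → ℝ)
  (σ : JointStrategy n i)

/-- The total payment in a round. -/
def totalPayment {t : ℕ} (h : History n t) (x : Noise n) : ℝ :=
  b * ((bidders α T b (quantileStrategy ρ) σ h x).card /
    (1 + (bidders α T b (quantileStrategy ρ) σ h x).card))

/-- The deviation of the payment of agent `i` from its conditional mean. -/
def ownDeviation {t : ℕ} (h : History n t) (x : Noise n) : ℝ :=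
  if 0 < budget α T b h i then
    payment b (playRound α T b (quantileStrategy ρ) σ h x) i -
      α i * b / ((rivals α T b (quantileStrategy ρ) σ h x).card + 2)
  else 0

/-- The deviation of the payment of the rivals from its conditional mean, in rounds in which
agent `i` has positive budget. -/
def rivalDeviation {t : ℕ} (h : History n t) (x : Noise n) : ℝ :=
  if 0 < budget α T b h i then
    totalPayment α T b ρ σ h x - payment b (playRound α T b (quantileStrategy ρ) σ h x) i -
      rivalRate (α i) b (rivals α T b (quantileStrategy ρ) σ h x).card
  else 0

/-- The deviation of the utility of agent `i` from its conditional mean. -/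
def utilityDeviation (v : ℝ) {t : ℕ} (h : History n t) (x : Noise n) : ℝ :=
  if 0 < budget α T b h i then
    (if (playRound α T b (quantileStrategy ρ) σ h x).win i = true then x.1 i else 0) -
      v / ((rivals α T b (quantileStrategy ρ) σ h x).card + 1)
  else 0

variable {ρ σ}

theorem measurable_winPlayRound (hρ : Measurable ρ) (hσ : σ.IsMeasurable) (t : ℕ) (j : Fin n) :
    Measurable fun p : History n t × Noise n =>
      (playRound α T b (quantileStrategy ρ) σ p.1 p.2).win j := by
  have h3 : Measurable fun R : Record n => R.win j := by unfold Record.win; fun_prop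
  exact h3.comp (measurable_playRound α T b hρ hσ t)

theorem measurable_rivals_card (hρ : Measurable ρ) (hσ : σ.IsMeasurable) (t : ℕ) (f : ℕ → ℝ) :
    Measurable fun p : History n t × Noise n =>
      f (rivals α T b (quantileStrategy ρ) σ p.1 p.2).card :=
  measurable_of_bidders α T b hρ hσ t (f := fun S _ => f (S.erase i).card)
    fun _ => measurable_const

theorem measurableSet_budget_pos (t : ℕ) :
    MeasurableSet {p : History n t × Noise n | 0 < budget α T b p.1 i} :=
  measurableSet_lt measurable_const ((measurable_budget α T b t i).comp measurable_fst)

theorem measurable_payment_playRound (hρ : Measurable ρ) (hσ : σ.IsMeasurable) (t : ℕ)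
    (j : Fin n) :
    Measurable fun p : History n t × Noise n =>
      payment b (playRound α T b (quantileStrategy ρ) σ p.1 p.2) j :=
  (measurable_payment b j).comp (measurable_playRound α T b hρ hσ t)

theorem mul_div_one_add_mem (hb : 0 ≤ b) (k : ℕ) :
    b * ((k : ℝ) / (1 + k)) ∈ Set.Icc 0 b := by
  have h1 : (k : ℝ) / (1 + k) ≤ 1 := (div_le_one (by positivity)).2 (by linarith)
  exact ⟨by positivity, by simpa using mul_le_mul_of_nonneg_left h1 hb⟩

theorem payment_mem (hb : 0 ≤ b) (R : Record n) (j : Fin n) : payment b R j ∈ Set.Icc 0 b := by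
  simp only [payment]
  split_ifs
  · exact mul_div_one_add_mem b hb _
  · exact ⟨le_rfl, hb⟩

variable {F : Fin n → Measure ℝ} [∀ j, IsProbabilityMeasure (F j)]

theorem abs_sub_le_of_mem_Icc {x y c : ℝ} (hx : x ∈ Set.Icc 0 c) (hy : y ∈ Set.Icc 0 c) :
    |x - y| ≤ c :=
  abs_le.2 ⟨by linarith [hx.1, hy.2], by linarith [hx.2, hy.1]⟩

/-- Against `m` rivals the mean payment is `α i * 1/(m+1) * c(m+1)/(m+2)`: the form `k/(k+1)` of the
price cancels the winning chance. -/
theorem isCentredIncrement_ownDeviation {c : NNReal} (hρ : IsTopQuantileRule (F i) (α i) ρ)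
    (hσ : σ.IsMeasurable) (hα : 0 ≤ α i) (hα1 : α i ≤ 1) :
    IsCentredIncrement (noiseLaw F) c fun _ h x => ownDeviation α T c ρ σ h x := by
  refine IsCentredIncrement.of_resampleAgent F i (fun t => ?_) (fun t h => ?_) (fun t h x => ?_)
  · exact Measurable.ite (measurableSet_budget_pos α T c t)
      ((measurable_payment_playRound α T c hρ.1.1 hσ t i).sub
        (measurable_rivals_card α T c hρ.1.1 hσ t fun m => α i * c / (m + 2))) measurable_const
  · refine Filter.Eventually.of_forall fun x => ?_
    unfold ownDeviation
    split_ifs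
    · refine abs_sub_le_of_mem_Icc (payment_mem c c.2 _ _) ⟨by positivity, ?_⟩
      rw [div_le_iff₀ (by positivity)]
      have h1 : α i * (c : ℝ) ≤ c := by simpa using mul_le_mul_of_nonneg_right hα1 c.2
      nlinarith [c.coe_nonneg, mul_nonneg c.coe_nonneg (Nat.cast_nonneg (α := ℝ)
        (rivals α T c (quantileStrategy ρ) σ h x).card)]
    · simp
  · unfold ownDeviation
    split_ifs with hB
    · obtain ⟨h1, h2⟩ := integral_agentLaw_win (μ := F i) hρ.1.1 hρ.1.2.1 hσ hB x
        (f := fun _ k => c * (k / (1 + k))) (fun _ => measurable_const) (c := c)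
        (Filter.Eventually.of_forall fun _ k => by
          rw [abs_of_nonneg (mul_div_one_add_mem c c.2 k).1]
          exact (mul_div_one_add_mem c c.2 k).2)
      simp only [payment_playRound, rivals_resampleAgent]
      rw [integral_sub h1 (integrable_const _), h2, integral_mul_const, hρ.2.1]
      simp only [integral_const, probReal_univ, one_smul]
      push_cast
      have hm := Nat.cast_nonneg (α := ℝ) (rivals α T c (quantileStrategy ρ) σ h x).card
      have h3 : ((rivals α T c (quantileStrategy ρ) σ h x).card : ℝ) + 1 ≠ 0 := by positivity
      have h4 : ((rivals α T c (quantileStrategy ρ) σ h x).card : ℝ) + 2 ≠ 0 := by positivity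
      have h5 : 1 + (((rivals α T c (quantileStrategy ρ) σ h x).card : ℝ) + 1) ≠ 0 := by
        positivity
      field_simp
      ring
    · simp

theorem rivalRate_mem {a : ℝ} (ha : 0 ≤ a) (ha1 : a ≤ 1) (hb : 0 ≤ b) (m : ℕ) :
    rivalRate a b m ∈ Set.Icc 0 b := by
  have h1 : 0 ≤ 1 - a := by linarith
  refine ⟨by unfold rivalRate; positivity, ?_⟩
  have h2 : a / ((m : ℝ) + 2) ≤ a / (m + 1) := by gcongr; norm_num
  have h3 : (m : ℝ) * (a / (m + 2) + (1 - a) / (m + 1)) ≤ 1 := by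
    calc (m : ℝ) * (a / (m + 2) + (1 - a) / (m + 1)) ≤ m * (a / (m + 1) + (1 - a) / (m + 1)) := by
          gcongr
      _ = m / (m + 1) := by rw [← add_div]; ring
      _ ≤ 1 := (div_le_one (by positivity)).2 (by linarith)
  unfold rivalRate
  rw [mul_assoc]
  simpa using mul_le_mul_of_nonneg_left h3 hb

/-- The rivals pay the total minus the payment of agent `i`. The total depends only on the number of
bidders, hence only on whether agent `i` bids, so no rival's winning chance has to be computed. -/
theorem isCentredIncrement_rivalDeviation {c : NNReal} (hρ : IsTopQuantileRule (F i) (α i) ρ)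
    (hσ : σ.IsMeasurable) (hα : 0 ≤ α i) (hα1 : α i ≤ 1) :
    IsCentredIncrement (noiseLaw F) c fun _ h x => rivalDeviation α T c ρ σ h x := by
  have htot : ∀ t, Measurable fun p : History n t × Noise n =>
      totalPayment α T c ρ σ p.1 p.2 := fun t =>
    measurable_of_bidders α T c hρ.1.1 hσ t
      (f := fun S _ => (c : ℝ) * ((S.card : ℝ) / (1 + S.card))) fun _ => measurable_const
  refine IsCentredIncrement.of_resampleAgent F i (fun t => ?_) (fun t h => ?_) (fun t h x => ?_)
  · exact Measurable.ite (measurableSet_budget_pos α T c t)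
      (((htot t).sub (measurable_payment_playRound α T c hρ.1.1 hσ t i)).sub
        (measurable_rivals_card α T c hρ.1.1 hσ t fun m => rivalRate (α i) c m))
      measurable_const
  · refine Filter.Eventually.of_forall fun x => ?_
    unfold rivalDeviation
    split_ifs
    · refine abs_sub_le_of_mem_Icc ?_ (rivalRate_mem c hα hα1 c.2 _)
      have h1 := mul_div_one_add_mem c c.2 (bidders α T c (quantileStrategy ρ) σ h x).card
      rw [payment_playRound]
      unfold totalPayment
      split_ifs
      · simp
      · simpa using h1
    · simp
  · unfold rivalDeviation
    split_ifs with hB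
    · obtain ⟨h1, h2⟩ := integral_agentLaw_win (μ := F i) hρ.1.1 hρ.1.2.1 hσ hB x
        (f := fun _ k => c * (k / (1 + k))) (fun _ => measurable_const) (c := c)
        (Filter.Eventually.of_forall fun _ k => by
          rw [abs_of_nonneg (mul_div_one_add_mem c c.2 k).1]
          exact (mul_div_one_add_mem c c.2 k).2)
      have hres : Measurable fun y : ℝ × ℝ × ({S : Finset (Fin n) // S.Nonempty} → Fin n) =>
          (h, resampleAgent i (x, y)) := by
        unfold resampleAgent
        exact measurable_const.prodMk (by fun_prop)
      have h0 : Integrable (fun y => totalPayment α T c ρ σ h (resampleAgent i (x, y)))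
          (agentLaw (F i)) := by
        refine Integrable.of_bound (C := c) ((htot t).comp hres).aestronglyMeasurable
          (Filter.Eventually.of_forall fun y => ?_)
        have h1 := mul_div_one_add_mem c c.2
          (bidders α T c (quantileStrategy ρ) σ h (resampleAgent i (x, y))).card
        rw [Real.norm_eq_abs]
        unfold totalPayment
        rw [abs_of_nonneg h1.1]
        exact h1.2
      set m := (rivals α T c (quantileStrategy ρ) σ h x).card with hm
      have h3 : ∀ y, totalPayment α T c ρ σ h (resampleAgent i (x, y)) =
          if y.2.1 < ρ y.1 then (c : ℝ) * ((m + 1) / (1 + (m + 1))) else c * (m / (1 + m)) := by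
        intro y
        unfold totalPayment
        rw [card_bidders hB, rivals_resampleAgent]
        simp only [resampleAgent, Function.update_self, ← hm]
        split_ifs <;> push_cast <;> simp
      have h4 : ∫ y, totalPayment α T c ρ σ h (resampleAgent i (x, y)) ∂(agentLaw (F i)) =
          α i * (c * ((m + 1) / (1 + (m + 1)))) + (1 - α i) * (c * (m / (1 + m))) := by
        simp only [h3]
        rw [integral_agentLaw_bid (F i) hρ.1.1 hρ.1.2.1, hρ.2.1]
      simp only [payment_playRound, rivals_resampleAgent]
      have h01 := integral_sub (h0.sub h1)
        (integrable_const (μ := agentLaw (n := n) (F i)) (rivalRate (α i) c m))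
      simp only [Pi.sub_apply] at h01
      rw [h01, integral_sub h0 h1, h2, h4, integral_mul_const, hρ.2.1]
      simp only [integral_const, probReal_univ, one_smul, rivalRate]
      push_cast
      have hm0 := Nat.cast_nonneg (α := ℝ) m
      have h5 : (m : ℝ) + 1 ≠ 0 := by positivity
      have h6 : (m : ℝ) + 2 ≠ 0 := by positivity
      have e1 : 1 + ((m : ℝ) + 1) = m + 2 := by ring
      have e2 : 1 + (m : ℝ) = m + 1 := by ring
      rw [e1, e2]
      field_simp
      ring
    · simp

theorem ae_noiseLaw_value_mem (hF : F i (Set.Icc 0 1) = 1) :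
    ∀ᵐ x ∂(noiseLaw F), x.1 i ∈ Set.Icc (0 : ℝ) 1 :=
  Measure.quasiMeasurePreserving_fst.ae
    ((measurePreserving_eval F i).quasiMeasurePreserving.ae (ae_mem_of_apply_eq_one hF))

theorem idealUtility_mem {μ : Measure ℝ} [IsProbabilityMeasure μ] {a : ℝ}
    (hμ : μ (Set.Icc 0 1) = 1) (hρ : IsTopQuantileRule μ a ρ) :
    idealUtility μ a ∈ Set.Icc (0 : ℝ) 1 := by
  rw [← hρ.2.2]
  have h := ae_mem_of_apply_eq_one hμ
  have h0 : ∀ᵐ v ∂μ, 0 ≤ v * ρ v := by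
    filter_upwards [h] with v hv using mul_nonneg hv.1 (hρ.1.2.1 v).1
  refine ⟨integral_nonneg_of_ae h0, ?_⟩
  calc ∫ v, v * ρ v ∂μ ≤ ∫ _, (1 : ℝ) ∂μ := by
        refine integral_mono_of_nonneg h0 (integrable_const _) ?_
        filter_upwards [h] with v hv using mul_le_one₀ hv.2 (hρ.1.2.1 v).1 (hρ.1.2.1 v).2
    _ = 1 := by simp

theorem abs_utilityDeviation_le {v : ℝ} (hv : v ∈ Set.Icc (0 : ℝ) 1) {t : ℕ} (h : History n t)
    {x : Noise n} (hx : x.1 i ∈ Set.Icc (0 : ℝ) 1) : |utilityDeviation α T b ρ σ v h x| ≤ 1 := by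
  unfold utilityDeviation
  split_ifs with hB hw
  · refine abs_sub_le_of_mem_Icc hx ⟨div_nonneg hv.1 (by positivity), ?_⟩
    rw [div_le_one (by positivity)]
    linarith [hv.2, Nat.cast_nonneg (α := ℝ) (rivals α T b (quantileStrategy ρ) σ h x).card]
  · refine abs_sub_le_of_mem_Icc ⟨le_rfl, zero_le_one⟩ ⟨div_nonneg hv.1 (by positivity), ?_⟩
    rw [div_le_one (by positivity)]
    linarith [hv.2, Nat.cast_nonneg (α := ℝ) (rivals α T b (quantileStrategy ρ) σ h x).card]
  · simp

/-- The winning chance `1/(m+1)` of a bid does not depend on the value, so the mean utility is `E[V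
ρ(V)]/(m+1)`, and `ρ` attains the ideal utility. -/
theorem isCentredIncrement_utilityDeviation (hF : F i (Set.Icc 0 1) = 1)
    (hρ : IsTopQuantileRule (F i) (α i) ρ) (hσ : σ.IsMeasurable) :
    IsCentredIncrement (noiseLaw F) 1 fun _ h x =>
      utilityDeviation α T b ρ σ (idealUtility (F i) (α i)) h x := by
  refine IsCentredIncrement.of_resampleAgent F i (fun t => ?_) (fun t h => ?_) (fun t h x => ?_)
  · refine Measurable.ite (measurableSet_budget_pos α T b t)
      (Measurable.sub (Measurable.ite ?_ (by fun_prop) measurable_const)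
        (measurable_rivals_card α T b hρ.1.1 hσ t
          fun m => idealUtility (F i) (α i) / (m + 1))) measurable_const
    exact measurable_winPlayRound α T b hρ.1.1 hσ t i (measurableSet_singleton true)
  · filter_upwards [ae_noiseLaw_value_mem hF] with x hx
    exact abs_utilityDeviation_le α T b (idealUtility_mem hF hρ) h hx
  · unfold utilityDeviation
    split_ifs with hB
    · obtain ⟨h1, h2⟩ := integral_agentLaw_win (μ := F i) hρ.1.1 hρ.1.2.1 hσ hB x
        (f := fun v _ => v) (fun _ => measurable_id) (c := 1) (by
          filter_upwards [ae_mem_of_apply_eq_one hF] with v hv _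
          rw [abs_of_nonneg hv.1]
          exact hv.2)
      have h3 : ∀ y : ℝ × ℝ × ({S : Finset (Fin n) // S.Nonempty} → Fin n),
          (resampleAgent i (x, y)).1 i = y.1 := fun y => by simp [resampleAgent]
      simp only [h3, rivals_resampleAgent]
      rw [integral_sub h1 (integrable_const _), h2, ← hρ.2.2]
      simp only [integral_const, probReal_univ, one_smul]
      simp only [mul_comm, sub_self]
    · simp

end

/-! ### Elementary inequalities -/

/-- The coefficient is chosen to give equality at `m = 0` and `m = 1`. The difference of the two
sides has the factor `m * (m - 1)`, which is nonnegative because `m` is an integer. -/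
theorem one_sub_rivalRate_le {a b : ℝ} (ha : 0 ≤ a) (ha1 : a ≤ 1) (hb : 0 < b) (m : ℕ) :
    1 - 3 / (b * (3 - a)) * rivalRate a b m ≤ 1 / ((m : ℝ) + 1) := by
  have h3 : 0 < 3 - a := by linarith
  rcases Nat.eq_zero_or_pos m with rfl | hm
  · simp [rivalRate]
  have hm1 : (1 : ℝ) ≤ m := by exact_mod_cast hm
  have h : 1 / ((m : ℝ) + 1) - (1 - 3 / (b * (3 - a)) * rivalRate a b m) =
      m * a * (m - 1) / ((m + 1) * (m + 2) * (3 - a)) := by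
    unfold rivalRate
    field_simp
    ring
  have h' : 0 ≤ m * a * (m - 1) / ((m + 1) * (m + 2) * (3 - a)) :=
    div_nonneg (mul_nonneg (by positivity) (by linarith)) (by positivity)
  linarith

/-- Again equality at `m = 0` and `m = 1` fixes both coefficients; `2/(m+2)` is the part controlled
by the spending of the agent herself. -/
theorem two_div_sub_rivalRate_le {a b : ℝ} (ha1 : a ≤ 1) (hb : 0 < b) (m : ℕ) :
    2 / ((m : ℝ) + 2) - 1 / (b * (3 - a)) * rivalRate a b m ≤ 1 / ((m : ℝ) + 1) := by
  have h3 : 0 < 3 - a := by linarith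
  rcases Nat.eq_zero_or_pos m with rfl | hm
  · simp [rivalRate]
  have hm1 : (1 : ℝ) ≤ m := by exact_mod_cast hm
  have h : 1 / ((m : ℝ) + 1) - (2 / ((m : ℝ) + 2) - 1 / (b * (3 - a)) * rivalRate a b m) =
      m * (m - 1) / ((m + 1) * (m + 2) * (3 - a)) := by
    unfold rivalRate
    field_simp
    ring
  have h' : 0 ≤ m * ((m : ℝ) - 1) / ((m + 1) * (m + 2) * (3 - a)) :=
    div_nonneg (mul_nonneg (by positivity) (by linarith)) (by positivity)
  linarith

/-- Let `A t` say that an agent of share `a` can still bid in round `t`, against `m t` rivals, and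
let `p t` and `q t` be the payments of this agent and of her rivals. If these are close to their
means on the whole, the rivals stay within their budgets, and the agent either can always bid or
spends all of her budget, then her winning chances add up to almost `robustFactor a b * T`. -/
theorem robustFactor_mul_sub_le {a b K ε : ℝ} (ha : 0 < a) (ha1 : a ≤ 1) (hb : 0 < b)
    (hK : 0 ≤ K) (hε : 0 ≤ ε) {T : ℕ} {A : ℕ → Prop} [DecidablePred A] {m : ℕ → ℕ} {p q : ℕ → ℝ}
    (hown : ∑ t ∈ Finset.range T, (if A t then p t - a * b / ((m t : ℝ) + 2) else 0) ≤ ε)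
    (hriv : ∑ t ∈ Finset.range T, -(if A t then q t - rivalRate a b (m t) else 0) ≤ ε)
    (hq : ∑ t ∈ Finset.range T, (if A t then q t else 0) ≤ (1 - a) * T + K)
    (hp : (∀ t ∈ Finset.range T, A t) ∨
      a * T ≤ ∑ t ∈ Finset.range T, if A t then p t else 0) :
    robustFactor a b * T - (2 / (a * b) + 3 / (b * (3 - a))) * (K + ε) ≤
      ∑ t ∈ Finset.range T, if A t then 1 / ((m t : ℝ) + 1) else 0 := by
  have h3 : 0 < 3 - a := by linarith
  have hriv' : ∑ t ∈ Finset.range T, (if A t then rivalRate a b (m t) else 0) ≤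
      (1 - a) * T + (K + ε) := by
    have e : ∑ t ∈ Finset.range T, -(if A t then q t - rivalRate a b (m t) else 0) =
        ∑ t ∈ Finset.range T, (if A t then rivalRate a b (m t) else 0) -
          ∑ t ∈ Finset.range T, (if A t then q t else 0) := by
      rw [← Finset.sum_sub_distrib]
      refine Finset.sum_congr rfl fun t _ => ?_
      split_ifs <;> ring
    linarith
  have hk1 : 0 < 1 / (b * (3 - a)) := by positivity
  have hk2 : 0 < 2 / (a * b) := by positivity
  have hk3 : 3 / (b * (3 - a)) = 3 * (1 / (b * (3 - a))) := by ring
  have h1 := mul_le_mul_of_nonneg_left hriv' hk1.le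
  have h2 : 0 ≤ 1 / (b * (3 - a)) * (K + ε) := by positivity
  have h4 : 0 ≤ 2 / (a * b) * K := by positivity
  have h5 : 0 ≤ 2 / (a * b) * ε := by positivity
  rcases hp with hp | hp
  -- Always alive: every round contributes the constant `1`, and only the spending of the rivals
  -- reduces it.
  · have e1 : ∑ t ∈ Finset.range T, (1 - 3 * (1 / (b * (3 - a))) *
        (if A t then rivalRate a b (m t) else 0)) ≤
        ∑ t ∈ Finset.range T, if A t then 1 / ((m t : ℝ) + 1) else 0 := by
      refine Finset.sum_le_sum fun t ht => ?_
      rw [if_pos (hp t ht), if_pos (hp t ht), ← hk3]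
      exact one_sub_rivalRate_le ha.le ha1 hb (m t)
    rw [Finset.sum_sub_distrib, ← Finset.mul_sum] at e1
    simp only [Finset.sum_const, Finset.card_range, nsmul_eq_mul, mul_one] at e1
    have e2 : robustFactor a b * T ≤ (1 - 3 * (1 / (b * (3 - a))) * (1 - a)) * T := by
      refine mul_le_mul_of_nonneg_right ((min_le_left _ _).trans (le_of_eq ?_))
        (Nat.cast_nonneg T)
      rw [show 3 * b - a * b = b * (3 - a) by ring]
      ring
    rw [hk3]
    generalize 1 / (b * (3 - a)) = k at *
    linarith
  -- Budget exhausted: the rounds alive are not counted; the spending `a * T` bounds the sum of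
  -- `1/(m+2)` from below instead.
  · have e1 : 2 * ∑ t ∈ Finset.range T, (if A t then 1 / ((m t : ℝ) + 2) else 0) -
        1 / (b * (3 - a)) * ∑ t ∈ Finset.range T, (if A t then rivalRate a b (m t) else 0) ≤
        ∑ t ∈ Finset.range T, if A t then 1 / ((m t : ℝ) + 1) else 0 := by
      rw [Finset.mul_sum, Finset.mul_sum, ← Finset.sum_sub_distrib]
      refine Finset.sum_le_sum fun t _ => ?_
      split_ifs
      · rw [mul_one_div]
        exact two_div_sub_rivalRate_le ha1 hb (m t)
      · simp
    have e2 : ∑ t ∈ Finset.range T, (if A t then p t - a * b / ((m t : ℝ) + 2) else 0) =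
        ∑ t ∈ Finset.range T, (if A t then p t else 0) -
          a * b * ∑ t ∈ Finset.range T, (if A t then 1 / ((m t : ℝ) + 2) else 0) := by
      rw [Finset.mul_sum, ← Finset.sum_sub_distrib]
      refine Finset.sum_congr rfl fun t _ => ?_
      split_ifs
      · rw [mul_one_div]
      · simp
    have e3 : 2 / (a * b) * (a * T - ε) ≤
        2 * ∑ t ∈ Finset.range T, (if A t then 1 / ((m t : ℝ) + 2) else 0) := by
      rw [div_mul_eq_mul_div, div_le_iff₀ (by positivity)]
      linarith
    have e4 : robustFactor a b * T ≤
        2 / (a * b) * (a * T) - 1 / (b * (3 - a)) * ((1 - a) * T) := by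
      refine (mul_le_mul_of_nonneg_right (min_le_right _ _) (Nat.cast_nonneg T)).trans
        (le_of_eq ?_)
      field_simp
      ring
    rw [hk3]
    generalize 1 / (b * (3 - a)) = k at *
    generalize 2 / (a * b) = l at *
    linarith

/-! ### Estimates for the robustness factor and the rate -/

theorem robustFactor_le_one {a b : ℝ} (ha1 : a ≤ 1) (hb : 0 < b) : robustFactor a b ≤ 1 := by
  refine (min_le_left _ _).trans ?_
  have : 0 ≤ 3 * (1 - a) / (3 * b - a * b) :=
    div_nonneg (by linarith) (by nlinarith)
  linarith

/-- At `a = 0` the two terms are `1 - 1/b` and `5/(3b)`; `b = 8/3` makes both equal to `5/8`, and a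
positive share only helps. -/
theorem five_eighths_le_robustFactor {a : ℝ} (ha : 0 ≤ a) (ha1 : a ≤ 1) :
    5 / 8 ≤ robustFactor a (8 / 3) := by
  refine le_min ?_ ?_
  · rw [le_sub_comm, div_le_iff₀ (by linarith)]
    linarith
  · rw [le_div_iff₀ (by linarith)]
    linarith

theorem rate_nonneg (T : ℕ) : 0 ≤ rate T := Real.sqrt_nonneg _

theorem sq_mul_rate {T : ℕ} (hT : 2 ≤ T) : (T * rate T) ^ 2 = T * Real.log T := by
  have hT1 : (1 : ℝ) ≤ T := by exact_mod_cast (by omega : 1 ≤ T)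
  rw [mul_pow, rate, Real.sq_sqrt (div_nonneg (Real.log_nonneg hT1) (by linarith))]
  field_simp

/-- Lets additive constants be absorbed into the error term; it rests on `2 log 2 > 1`. -/
theorem one_le_mul_rate {T : ℕ} (hT : 2 ≤ T) : 1 ≤ T * rate T := by
  have hT2 : (2 : ℝ) ≤ T := by exact_mod_cast hT
  have h1 : Real.log 2 ≤ Real.log T := Real.log_le_log (by norm_num) hT2
  have h2 := Real.log_two_gt_d9
  have h3 := sq_mul_rate hT
  have h4 : 0 ≤ T * rate T := mul_nonneg (by linarith) (rate_nonneg T)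
  nlinarith

/-- The factor `2` in the deviation `2c√(T log T)` is what makes the Azuma bound exactly `T⁻²`. -/
theorem exp_azuma_rate {T : ℕ} (hT : 2 ≤ T) {c : ℝ} (hc : 0 < c) :
    Real.exp (-(2 * c * (T * rate T)) ^ 2 / (2 * (T * c ^ 2))) = 1 / (T : ℝ) ^ 2 := by
  have hT0 : (0 : ℝ) < T := by exact_mod_cast (by omega : 0 < T)
  have h : -(2 * c * (T * rate T)) ^ 2 / (2 * (T * c ^ 2)) = -(2 * Real.log T) := by
    rw [mul_pow, sq_mul_rate hT]
    field_simp
  rw [h, Real.exp_neg, two_mul, Real.exp_add, Real.exp_log hT0, one_div, sq]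

/-! ### Pathwise bounds -/

section

variable {n : ℕ} {i : Fin n} (α : Fin n → ℝ) (T : ℕ) (b : ℝ) (ρ : ℝ → ℝ)
  (σ : JointStrategy n i)

theorem sum_payment_playRound {t : ℕ} (h : History n t) (x : Noise n) :
    ∑ j, payment b (playRound α T b (quantileStrategy ρ) σ h x) j = totalPayment α T b ρ σ h x := by
  simp only [payment_playRound, totalPayment]
  by_cases hS : (bidders α T b (quantileStrategy ρ) σ h x).Nonempty
  · simp [playRound, Record.win, hS]
  · simp [playRound, Record.win, Finset.not_nonempty_iff_eq_empty.1 hS]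

variable {ρ σ} {ω : ℕ → Noise n}

theorem not_win_of_budget_nonpos (hω : ∀ t S, (ω t).2.2 S ∈ S.1)
    {t : ℕ} {h : History n t} {j : Fin n}
    (hB : ¬ 0 < budget α T b h j) :
    ¬ (playRound α T b (quantileStrategy ρ) σ h (ω t)).win j = true := by
  intro hw
  by_cases hS : (bidders α T b (quantileStrategy ρ) σ h (ω t)).Nonempty
  · simp only [playRound, Record.win, hS, dif_pos, decide_eq_true_eq] at hw
    have h1 := hω t ⟨_, hS⟩
    rw [hw] at h1
    exact hB (Finset.mem_filter.1 h1).2.2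
  · simp [playRound, Record.win, hS] at hw

theorem payment_of_budget_nonpos (hω : ∀ t S, (ω t).2.2 S ∈ S.1)
    {t : ℕ} {h : History n t} {j : Fin n}
    (hB : ¬ 0 < budget α T b h j) :
    payment b (playRound α T b (quantileStrategy ρ) σ h (ω t)) j = 0 := by
  rw [payment_playRound, if_neg (not_win_of_budget_nonpos α T b hω hB)]

/-- Only an agent with positive budget can pay, and a single payment is at most `b`, so the last
payment overdraws by at most `b`. -/
theorem neg_le_budget_history (hω : ∀ t S, (ω t).2.2 S ∈ S.1)
    (hα : ∀ j, 0 ≤ α j) (hb : 0 ≤ b) (t : ℕ) (j : Fin n) :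
    -b ≤ budget α T b (history α T b (quantileStrategy ρ) σ ω t) j := by
  induction t with
  | zero =>
    rw [budget_history]
    have := mul_nonneg (hα j) (Nat.cast_nonneg (α := ℝ) T)
    simp only [Finset.range_zero, Finset.sum_empty]
    linarith
  | succ t ih =>
    have h1 : budget α T b (history α T b (quantileStrategy ρ) σ ω (t + 1)) j =
        budget α T b (history α T b (quantileStrategy ρ) σ ω t) j - payment b
          (playRound α T b (quantileStrategy ρ) σ
            (history α T b (quantileStrategy ρ) σ ω t) (ω t)) j := by
      rw [budget_history, budget_history, Finset.sum_range_succ]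
      ring
    rw [h1]
    by_cases hB : 0 < budget α T b (history α T b (quantileStrategy ρ) σ ω t) j
    · linarith [(payment_mem b hb (playRound α T b (quantileStrategy ρ) σ
            (history α T b (quantileStrategy ρ) σ ω t) (ω t)) j).2]
    · rw [payment_of_budget_nonpos α T b hω hB, sub_zero]
      exact ih

theorem sum_rival_payment_le (hω : ∀ t S, (ω t).2.2 S ∈ S.1)
    (hα : ∀ j, 0 ≤ α j) (hsum : ∑ j, α j = 1) (hb : 0 ≤ b) (m : ℕ) :
    ∑ t ∈ Finset.range m, (totalPayment α T b ρ σ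
        (history α T b (quantileStrategy ρ) σ ω t) (ω t) -
      payment b (playRound α T b (quantileStrategy ρ) σ
        (history α T b (quantileStrategy ρ) σ ω t) (ω t)) i) ≤ (1 - α i) * T + n * b := by
  have h1 : ∀ t, totalPayment α T b ρ σ (history α T b (quantileStrategy ρ) σ ω t) (ω t) -
      payment b (playRound α T b (quantileStrategy ρ) σ
        (history α T b (quantileStrategy ρ) σ ω t) (ω t)) i =
      ∑ j ∈ Finset.univ.erase i, payment b (playRound α T b (quantileStrategy ρ) σ
        (history α T b (quantileStrategy ρ) σ ω t) (ω t)) j := by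
    intro t
    rw [← sum_payment_playRound, ← Finset.add_sum_erase _ _ (Finset.mem_univ i)]
    ring
  simp only [h1]
  rw [Finset.sum_comm]
  have h2 : ∀ j, ∑ t ∈ Finset.range m, payment b (playRound α T b (quantileStrategy ρ) σ
        (history α T b (quantileStrategy ρ) σ ω t) (ω t)) j ≤ α j * T + b := by
    intro j
    have h3 := neg_le_budget_history α T b (ρ := ρ) (σ := σ) hω hα hb m j
    rw [budget_history] at h3
    linarith
  calc ∑ j ∈ Finset.univ.erase i, ∑ t ∈ Finset.range m,
        payment b (playRound α T b (quantileStrategy ρ) σ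
          (history α T b (quantileStrategy ρ) σ ω t) (ω t)) j
      ≤ ∑ j ∈ Finset.univ.erase i, (α j * T + b) := Finset.sum_le_sum fun j _ => h2 j
    _ = (1 - α i) * T + ((Finset.univ.erase i).card : ℝ) * b := by
        rw [Finset.sum_add_distrib, ← Finset.sum_mul, Finset.sum_const, nsmul_eq_mul, ← hsum,
          ← Finset.add_sum_erase _ α (Finset.mem_univ i)]
        ring
    _ ≤ (1 - α i) * T + n * b := by
        have : ((Finset.univ.erase i).card : ℝ) ≤ n := by
          exact_mod_cast (Finset.card_le_univ _).trans (by simp)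
        gcongr

end

/-! ### The number of effective wins -/

section

variable {n : ℕ} {i : Fin n} (α : Fin n → ℝ) (T : ℕ) (b : ℝ) (ρ : ℝ → ℝ)
  (σ : JointStrategy n i)

/-- The probability that agent `i` would win round `t` when bidding, given the bids of the
rivals; zero when she has no budget. -/
def winChance {t : ℕ} (h : History n t) (x : Noise n) : ℝ :=
  if 0 < budget α T b h i then
    1 / (((rivals α T b (quantileStrategy ρ) σ h x).card : ℝ) + 1) else 0

theorem winChance_mem {t : ℕ} (h : History n t) (x : Noise n) :
    winChance α T b ρ σ h x ∈ Set.Icc (0 : ℝ) 1 := by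
  unfold winChance
  split_ifs
  · refine ⟨by positivity, (div_le_one (by positivity)).2 ?_⟩
    linarith [Nat.cast_nonneg (α := ℝ) (rivals α T b (quantileStrategy ρ) σ h x).card]
  · simp

variable {ρ σ}

theorem measurable_winChance (hρ : Measurable ρ) (hσ : σ.IsMeasurable) (t : ℕ) :
    Measurable fun p : History n t × Noise n => winChance α T b ρ σ p.1 p.2 :=
  Measurable.ite (measurableSet_budget_pos α T b t)
    (measurable_rivals_card α T b hρ hσ t fun m => 1 / ((m : ℝ) + 1)) measurable_const

/-- The sum of the winning chances is large unless the payments deviate from their means: either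
agent `i` keeps a positive budget, and the rivals' budgets limit their competition, or she has
spent her budget on wins. -/
theorem le_sum_winChance {ω : ℕ → Noise n} (hω : ∀ t S, (ω t).2.2 S ∈ S.1)
    (hα : ∀ j, 0 < α j) (hsum : ∑ j, α j = 1) (hα1 : α i ≤ 1) (hb : 0 < b) {ε : ℝ} (hε : 0 ≤ ε)
    (hown : ∑ t ∈ Finset.range T, ownDeviation α T b ρ σ
      (history α T b (quantileStrategy ρ) σ ω t) (ω t) ≤ ε)
    (hriv : ∑ t ∈ Finset.range T, -rivalDeviation α T b ρ σ
      (history α T b (quantileStrategy ρ) σ ω t) (ω t) ≤ ε) :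
    robustFactor (α i) b * T - (2 / (α i * b) + 3 / (b * (3 - α i))) * (n * b + ε) ≤
      ∑ t ∈ Finset.range T, winChance α T b ρ σ
        (history α T b (quantileStrategy ρ) σ ω t) (ω t) := by
  refine robustFactor_mul_sub_le (hα i) hα1 hb (by positivity) hε hown hriv ?_ ?_
  · refine (Finset.sum_le_sum fun t _ => ?_).trans
      (sum_rival_payment_le α T b (ρ := ρ) (σ := σ) hω (fun j => (hα j).le) hsum hb.le T)
    split_ifs
    · exact le_rfl
    · rw [sub_nonneg, ← sum_payment_playRound]
      exact Finset.single_le_sum (fun j _ => (payment_mem b hb.le _ j).1) (Finset.mem_univ i)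
  -- If the budget is gone before some round `t₀`, the payments before `t₀` add up to at least `α i
  -- * T`. Payments in rounds without budget are zero, so restricting to the other rounds loses
  -- nothing.
  · refine or_iff_not_imp_left.2 fun halive => ?_
    push Not at halive
    obtain ⟨t₀, ht₀, hdead⟩ := halive
    rw [budget_history] at hdead
    refine (sub_nonpos.1 hdead).trans ?_
    refine (Finset.sum_le_sum_of_subset_of_nonneg
        (Finset.range_subset_range.2 (Finset.mem_range.1 ht₀).le)
        fun t _ _ => (payment_mem b hb.le _ _).1).trans (Finset.sum_le_sum fun t _ => ?_)
    split_ifs with h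
    · exact le_rfl
    · exact (payment_of_budget_nonpos α T b hω h).le

end

/-! ### Robustness -/

section

variable {n : ℕ} {i : Fin n} {α : Fin n → ℝ} {T : ℕ} {b : ℝ} {ρ : ℝ → ℝ}
  {σ : JointStrategy n i} {F : Fin n → Measure ℝ} [∀ j, IsProbabilityMeasure (F j)]

theorem ae_gameLaw_of_ae_noiseLaw {p : Noise n → Prop} (h : ∀ᵐ x ∂(noiseLaw F), p x) :
    ∀ᵐ ω ∂(gameLaw F), ∀ t, p (ω t) :=
  ae_all_iff.2 fun t =>
    (measurePreserving_eval_infinitePi (fun _ : ℕ => noiseLaw F) t).quasiMeasurePreserving.ae h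

/-- The noise space also contains selections outside `S`. They form a null set, so the pathwise
bounds may assume that every winner is a bidder. -/
theorem ae_noiseLaw_selection_mem (F : Fin n → Measure ℝ) [∀ j, IsProbabilityMeasure (F j)] :
    ∀ᵐ x ∂(noiseLaw F), ∀ S, x.2.2 S ∈ S.1 := by
  refine ae_all_iff.2 fun S => ?_
  have h1 : ∀ᵐ k ∂(PMF.uniformOfFinset S.1 S.2).toMeasure, k ∈ S.1 := by
    rw [ae_iff, PMF.toMeasure_apply_eq_zero_iff _ (MeasurableSet.of_discrete),
      Set.disjoint_left]
    intro k hk hk'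
    exact hk' ((PMF.mem_support_uniformOfFinset_iff S.2 k).1 hk)
  have h2 : ∀ᵐ w ∂(selectionLaw n), w S ∈ S.1 :=
    (measurePreserving_eval (fun S : {S : Finset (Fin n) // S.Nonempty} =>
      (PMF.uniformOfFinset S.1 S.2).toMeasure) S).quasiMeasurePreserving.ae h1
  exact Measure.quasiMeasurePreserving_snd.ae (Measure.quasiMeasurePreserving_snd.ae h2)

theorem utility_eq (ω : ℕ → Noise n) (t : Fin T) :
    utility α T b (quantileStrategy ρ) σ t ω =
      if (playRound α T b (quantileStrategy ρ) σ (history α T b (quantileStrategy ρ) σ ω t)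
        (ω t)).win i = true then (ω t).1 i else 0 := by
  simp only [utility, history_apply]
  rfl

theorem utility_nonneg {ω : ℕ → Noise n} (hv : ∀ t, (ω t).1 i ∈ Set.Icc (0 : ℝ) 1) (t : Fin T) :
    0 ≤ utility α T b (quantileStrategy ρ) σ t ω := by
  rw [utility_eq]
  split_ifs
  exacts [(hv t).1, le_rfl]

/-- Drift plus martingale increment: the first term is bounded pathwise, the second vanishes in
expectation and concentrates. -/
theorem utility_eq_add {ω : ℕ → Noise n} (hω : ∀ t S, (ω t).2.2 S ∈ S.1) (v : ℝ) (t : Fin T) :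
    utility α T b (quantileStrategy ρ) σ t ω =
      v * winChance α T b ρ σ (history α T b (quantileStrategy ρ) σ ω t) (ω t) +
        utilityDeviation α T b ρ σ v (history α T b (quantileStrategy ρ) σ ω t) (ω t) := by
  rw [utility_eq]
  unfold winChance utilityDeviation
  split_ifs with hw hB hB
  · ring
  · exact absurd hw (not_win_of_budget_nonpos α T b hω hB)
  · ring
  · ring

/-- The loss in the robustness factor per unit of `rate T`. -/
def lossConstant (n : ℕ) (a b : ℝ) : ℝ := (2 / (a * b) + 3 / (b * (3 - a))) * (n * b + 2 * b)

theorem lossConstant_nonneg {a : ℝ} (ha : 0 < a) (ha1 : a ≤ 1) (hb : 0 < b) :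
    0 ≤ lossConstant n a b := by
  have h3 : 0 < 3 - a := by linarith
  unfold lossConstant
  positivity

/-- The event that the payments of agent `i`, or those of her rivals, deviate much from their
means. -/
def paymentDeviationEvent (α : Fin n → ℝ) (T : ℕ) (b : ℝ) (ρ : ℝ → ℝ) (σ : JointStrategy n i) :
    Set (ℕ → Noise n) :=
  {ω | 2 * b * (T * rate T) ≤ ∑ t ∈ Finset.range T, ownDeviation α T b ρ σ
      (history α T b (quantileStrategy ρ) σ ω t) (ω t)} ∪
    {ω | 2 * b * (T * rate T) ≤ ∑ t ∈ Finset.range T, -rivalDeviation α T b ρ σ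
      (history α T b (quantileStrategy ρ) σ ω t) (ω t)}

theorem mul_le_sum_winChance {ω : ℕ → Noise n} (hω : ∀ t S, (ω t).2.2 S ∈ S.1)
    (hα : ∀ j, 0 < α j) (hsum : ∑ j, α j = 1) (hα1 : α i ≤ 1) (hb : 0 < b) (hT : 2 ≤ T)
    (hdev : ω ∉ paymentDeviationEvent α T b ρ σ) :
    (robustFactor (α i) b - lossConstant n (α i) b * rate T) * T ≤
      ∑ t ∈ Finset.range T, winChance α T b ρ σ
        (history α T b (quantileStrategy ρ) σ ω t) (ω t) := by
  have hr := one_le_mul_rate hT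
  have hε : 0 ≤ 2 * b * (T * rate T) := by positivity
  simp only [paymentDeviationEvent, Set.mem_union, Set.mem_ofPred_eq, not_or, not_le] at hdev
  refine le_trans ?_ (le_sum_winChance α T b hω hα hsum hα1 hb hε hdev.1.le hdev.2.le)
  have h3 : 0 < 3 - α i := by linarith
  have hk : 0 ≤ 2 / (α i * b) + 3 / (b * (3 - α i)) := by have := hα i; positivity
  -- The overdraft `n * b` of the budgets is absorbed using `1 ≤ T * rate T`.
  have h1 : n * b + 2 * b * (T * rate T) ≤ (n * b + 2 * b) * (T * rate T) := by
    have : n * b * 1 ≤ n * b * (T * rate T) := mul_le_mul_of_nonneg_left hr (by positivity)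
    linarith
  have h2 := mul_le_mul_of_nonneg_left h1 hk
  unfold lossConstant
  linarith

theorem measureReal_paymentDeviationEvent_le (hρ : IsTopQuantileRule (F i) (α i) ρ)
    (hσ : σ.IsMeasurable) (hα : 0 < α i) (hα1 : α i ≤ 1) (hb : 0 < b) (hT : 2 ≤ T) :
    (gameLaw F).real (paymentDeviationEvent α T b ρ σ) ≤ 2 / (T : ℝ) ^ 2 := by
  lift b to NNReal using hb.le
  have hr := one_le_mul_rate hT
  have hε : 0 ≤ 2 * (b : ℝ) * (T * rate T) := by positivity
  have h1 := (isCentredIncrement_ownDeviation α T (c := b) hρ hσ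
    hα.le hα1).measureReal_sum_ge_le α T b hρ.1.1 hσ T hε
  have h2 := (isCentredIncrement_rivalDeviation α T (c := b) hρ hσ
    hα.le hα1).neg.measureReal_sum_ge_le α T b hρ.1.1 hσ T hε
  rw [exp_azuma_rate hT hb] at h1 h2
  refine (measureReal_union_le _ _).trans ((add_le_add h1 h2).trans (le_of_eq ?_))
  ring

/-- Robustness in expectation. -/
theorem isRobust_quantileStrategy (hα : ∀ j, 0 < α j) (hsum : ∑ j, α j = 1) (hα1 : α i ≤ 1)
    (hb : 0 < b) (hF : F i (Set.Icc 0 1) = 1) (hT : 2 ≤ T)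
    (hρ : IsTopQuantileRule (F i) (α i) ρ) :
    IsRobust α T b F i (quantileStrategy ρ)
      (robustFactor (α i) b - (lossConstant n (α i) b + 2) * rate T) := by
  intro σ hσ
  have hT0 : (0 : ℝ) < T := by exact_mod_cast (by omega : 0 < T)
  have hr := one_le_mul_rate hT
  set v := idealUtility (F i) (α i) with hv
  have hv01 : v ∈ Set.Icc (0 : ℝ) 1 := idealUtility_mem hF hρ
  have hsel := ae_gameLaw_of_ae_noiseLaw (ae_noiseLaw_selection_mem F)
  have hval := ae_gameLaw_of_ae_noiseLaw (ae_noiseLaw_value_mem (F := F) hF)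
  set W : ℕ → (ℕ → Noise n) → ℝ := fun t ω =>
    winChance α T b ρ σ (history α T b (quantileStrategy ρ) σ ω t) (ω t) with hW
  have hWi : ∀ t, Integrable (W t) (gameLaw F) := fun t =>
    Integrable.of_bound (C := 1)
      (measurable_comp_history α T b hρ.1.1 hσ
        (measurable_winChance α T b hρ.1.1 hσ t)).aestronglyMeasurable
      (Filter.Eventually.of_forall fun ω => by
        have := winChance_mem α T b ρ σ (history α T b (quantileStrategy ρ) σ ω t) (ω t)
        rw [Real.norm_eq_abs, abs_of_nonneg this.1]
        exact this.2)
  have hinc := isCentredIncrement_utilityDeviation α T b (F := F) hF hρ hσ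
  have hU : ∀ t : Fin T, ∫ ω, utility α T b (quantileStrategy ρ) σ t ω ∂(gameLaw F) =
      v * ∫ ω, W t ω ∂(gameLaw F) := by
    intro t
    have hDi : Integrable (fun ω => utilityDeviation α T b ρ σ v
        (history α T b (quantileStrategy ρ) σ ω t) (ω t)) (gameLaw F) := by
      refine Integrable.of_bound (C := 1)
        (measurable_comp_history α T b hρ.1.1 hσ (hinc.measurable t)).aestronglyMeasurable ?_
      filter_upwards [hval] with ω hω
      exact abs_utilityDeviation_le α T b hv01 _ (hω t)
    have h0 := hinc.integral_history α T b t hDi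
    have h1 : ∫ ω, utility α T b (quantileStrategy ρ) σ t ω ∂(gameLaw F) =
        ∫ ω, (v * W t ω + utilityDeviation α T b ρ σ v
          (history α T b (quantileStrategy ρ) σ ω t) (ω t)) ∂(gameLaw F) := by
      refine integral_congr_ae ?_
      filter_upwards [hsel] with ω hω using utility_eq_add hω v t
    rw [h1, integral_add ((hWi t).const_mul v) hDi, h0, add_zero, integral_const_mul]
  simp only [hU]
  rw [← Finset.mul_sum, ← Finset.sum_range fun t => ∫ ω, W t ω ∂(gameLaw F),
    ← integral_finsetSum _ fun t _ => hWi t, mul_left_comm, mul_comm]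
  refine mul_le_mul_of_nonneg_left ?_ hv01.1
  rw [one_div, inv_mul_eq_div, le_div_iff₀ hT0]
  set N : (ℕ → Noise n) → ℝ := fun ω => ∑ t ∈ Finset.range T, W t ω with hN
  have hN0 : ∀ ω, 0 ≤ N ω := fun ω => Finset.sum_nonneg fun t _ =>
    (winChance_mem α T b ρ σ _ _).1
  have hNi : Integrable N (gameLaw F) := integrable_finsetSum _ fun t _ => hWi t
  set A := robustFactor (α i) b - lossConstant n (α i) b * rate T with hA
  have hA1 : A ≤ 1 := by
    have := mul_nonneg (lossConstant_nonneg (n := n) (hα i) hα1 hb) (rate_nonneg T)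
    have := robustFactor_le_one hα1 hb
    linarith
  have hgoal : (robustFactor (α i) b - (lossConstant n (α i) b + 2) * rate T) * T =
      A * T - 2 * (T * rate T) := by rw [hA]; ring
  rw [hgoal]
  have hEN : 0 ≤ ∫ ω, N ω ∂(gameLaw F) := integral_nonneg hN0
  -- For `A ≤ 0` the bound is trivial. Otherwise Markov's inequality gives `E N ≥ A * T * (1 -
  -- 2/T^2)`, and the loss `2A/T ≤ 1` is covered by `2 * (T * rate T)`.
  rcases le_or_gt A 0 with hA0 | hA0
  · have := mul_nonpos_of_nonpos_of_nonneg hA0 hT0.le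
    linarith
  · have hmarkov := mul_meas_ge_le_integral_of_nonneg (Filter.Eventually.of_forall hN0) hNi (A * T)
    have hprob : 1 - 2 / (T : ℝ) ^ 2 ≤ (gameLaw F).real {ω | A * T ≤ N ω} := by
      have h1 := measureReal_paymentDeviationEvent_le (σ := σ) hρ hσ (hα i) hα1 hb hT
      have h2 : (gameLaw F).real Set.univ ≤ (gameLaw F).real
          ({ω | A * T ≤ N ω} ∪ paymentDeviationEvent α T b ρ σ) := by
        refine ENNReal.toReal_mono (measure_ne_top _ _) (measure_mono_ae ?_)
        filter_upwards [hsel] with ω hω _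
        refine or_iff_not_imp_right.2 fun hdev => ?_
        exact mul_le_sum_winChance hω hα hsum hα1 hb hT hdev
      rw [probReal_univ] at h2
      have h3 := measureReal_union_le (μ := gameLaw F) {ω | A * T ≤ N ω}
        (paymentDeviationEvent α T b ρ σ)
      linarith
    have h4 := (mul_le_mul_of_nonneg_left hprob (mul_nonneg hA0.le hT0.le)).trans hmarkov
    have h5 : A * T * (1 - 2 / (T : ℝ) ^ 2) = A * T - A * (2 / T) := by
      field_simp
    have h6 : A * (2 / T) ≤ 1 * 1 := by
      refine mul_le_mul hA1 ((div_le_one hT0).2 (by exact_mod_cast hT)) (by positivity)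
        zero_le_one
    linarith

/-- Robustness with high probability. -/
theorem measureReal_utility_ge (hα : ∀ j, 0 < α j) (hsum : ∑ j, α j = 1) (hα1 : α i ≤ 1)
    (hb : 0 < b) (hF : F i (Set.Icc 0 1) = 1) (hT : 2 ≤ T)
    (hρ : IsTopQuantileRule (F i) (α i) ρ) (hσ : σ.IsMeasurable) {C : ℝ}
    (hC : lossConstant n (α i) b + 2 / idealUtility (F i) (α i) ≤ C) :
    1 - 3 / (T : ℝ) ^ 2 ≤ (gameLaw F).real {ω | (robustFactor (α i) b - C * rate T) *
      idealUtility (F i) (α i) ≤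
        (1 / (T : ℝ)) * ∑ t, utility α T b (quantileStrategy ρ) σ t ω} := by
  have hT0 : (0 : ℝ) < T := by exact_mod_cast (by omega : 0 < T)
  have hr := one_le_mul_rate hT
  set v := idealUtility (F i) (α i) with hv
  have hv01 : v ∈ Set.Icc (0 : ℝ) 1 := idealUtility_mem hF hρ
  have hsel := ae_gameLaw_of_ae_noiseLaw (ae_noiseLaw_selection_mem F)
  have hval := ae_gameLaw_of_ae_noiseLaw (ae_noiseLaw_value_mem (F := F) hF)
  set E : Set (ℕ → Noise n) := {ω | (robustFactor (α i) b - C * rate T) * v ≤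
    (1 / (T : ℝ)) * ∑ t, utility α T b (quantileStrategy ρ) σ t ω} with hE
  set B : Set (ℕ → Noise n) := {ω | 2 * 1 * (T * rate T) ≤ ∑ t ∈ Finset.range T,
    -utilityDeviation α T b ρ σ v (history α T b (quantileStrategy ρ) σ ω t) (ω t)} with hB
  have hBle : (gameLaw F).real B ≤ 1 / (T : ℝ) ^ 2 := by
    have h1 := (isCentredIncrement_utilityDeviation α T b (F := F) hF hρ
      hσ).neg.measureReal_sum_ge_le α T b hρ.1.1 hσ T
      (show 0 ≤ 2 * 1 * (T * rate T) by positivity)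
    rw [NNReal.coe_one, exp_azuma_rate hT one_pos] at h1
    exact h1
  have hPle := measureReal_paymentDeviationEvent_le (σ := σ) hρ hσ (hα i) hα1 hb hT
  have hcover : (gameLaw F).real Set.univ ≤ (gameLaw F).real
      (E ∪ (paymentDeviationEvent α T b ρ σ ∪ B)) := by
    refine ENNReal.toReal_mono (measure_ne_top _ _) (measure_mono_ae ?_)
    filter_upwards [hsel, hval] with ω hω hωv _
    refine or_iff_not_imp_right.2 fun hdev => ?_
    simp only [Set.mem_union, not_or] at hdev
    change (robustFactor (α i) b - C * rate T) * v ≤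
      (1 / (T : ℝ)) * ∑ t, utility α T b (quantileStrategy ρ) σ t ω
    -- If the ideal utility is zero, then `2 / v` carries no information, but the claim reduces to
    -- nonnegativity of the utility.
    rcases eq_or_lt_of_le hv01.1 with hv0 | hv0
    · rw [← hv0, mul_zero]
      exact mul_nonneg (by positivity) (Finset.sum_nonneg fun t _ => utility_nonneg hωv t)
    · have h1 := mul_le_sum_winChance hω hα hsum hα1 hb hT hdev.1
      have h2 := hdev.2
      simp only [hB, Set.mem_ofPred_eq, not_le, Finset.sum_neg_distrib] at h2
      rw [one_div, inv_mul_eq_div, le_div_iff₀ hT0]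
      simp only [utility_eq_add hω v]
      rw [← Finset.sum_range fun t => v * winChance α T b ρ σ
          (history α T b (quantileStrategy ρ) σ ω t) (ω t) +
        utilityDeviation α T b ρ σ v (history α T b (quantileStrategy ρ) σ ω t) (ω t),
        Finset.sum_add_distrib, ← Finset.mul_sum]
      have h3 := mul_le_mul_of_nonneg_left h1 hv0.le
      -- The summand `2 / v` turns the additive utility deviation `2 * (T * rate T)` into a multiple
      -- of `v`.
      have h4 : (lossConstant n (α i) b + 2 / v) * v ≤ C * v :=
        mul_le_mul_of_nonneg_right hC hv0.le
      rw [add_mul, div_mul_cancel₀ _ hv0.ne'] at h4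
      have h5 := mul_le_mul_of_nonneg_right h4 (show 0 ≤ T * rate T by positivity)
      linarith
  rw [probReal_univ] at hcover
  have h1 := measureReal_union_le (μ := gameLaw F) E (paymentDeviationEvent α T b ρ σ ∪ B)
  have h2 := measureReal_union_le (μ := gameLaw F) (paymentDeviationEvent α T b ρ σ) B
  have h3 : 3 / (T : ℝ) ^ 2 = 2 / (T : ℝ) ^ 2 + 1 / (T : ℝ) ^ 2 := by ring
  linarith

theorem IsRobust.mono {π : Strategy n} {l l' : ℝ} (h : IsRobust α T b F i π l) (hl : l' ≤ l)
    (hv : 0 ≤ idealUtility (F i) (α i)) : IsRobust α T b F i π l' := fun σ hσ =>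
  (mul_le_mul_of_nonneg_right hl hv).trans (h σ hσ)

end

end CompetitiveSubsidy

end

/-! ### The main theorem: choice of the constants -/

open CompetitiveSubsidy in
theorem theorem1 {n : ℕ} (α : Fin n → ℝ) (hα : ∀ j, 0 < α j) (hsum : ∑ j, α j = 1) (i : Fin n) :
    -- payment constant `8/3`: robustness factor `5/8 - O(√(log T / T))`
    (∃ C : ℝ, 0 < C ∧
      ∀ (F : Fin n → MeasureTheory.Measure ℝ) [∀ j, MeasureTheory.IsProbabilityMeasure (F j)],
        (∀ j, F j (Set.Icc 0 1) = 1) →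
        ∀ T : ℕ, 2 ≤ T → ∀ π : Strategy n, IsAggressive (F i) (α i) π →
          IsRobust α T (8 / 3) F i π (5 / 8 - C * rate T)) ∧
    -- every payment constant `b ≥ 2`
    (∀ b : ℝ, 2 ≤ b →
      -- in expectation
      (∃ C : ℝ, 0 < C ∧
        ∀ (F : Fin n → MeasureTheory.Measure ℝ) [∀ j, MeasureTheory.IsProbabilityMeasure (F j)],
          (∀ j, F j (Set.Icc 0 1) = 1) →
          ∀ T : ℕ, 2 ≤ T → ∀ π : Strategy n, IsAggressive (F i) (α i) π →
            IsRobust α T b F i π (robustFactor (α i) b - C * rate T)) ∧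
      -- with high probability; the constant may depend on the value distribution `μ` of agent `i`
      (∀ μ : MeasureTheory.Measure ℝ, ∃ C : ℝ, 0 < C ∧
        ∀ (F : Fin n → MeasureTheory.Measure ℝ) [∀ j, MeasureTheory.IsProbabilityMeasure (F j)],
          (∀ j, F j (Set.Icc 0 1) = 1) → F i = μ →
          ∀ T : ℕ, 2 ≤ T → ∀ π : Strategy n, IsAggressive (F i) (α i) π →
            ∀ σ : JointStrategy n i, σ.IsMeasurable →
              1 - C / (T : ℝ) ^ 2 ≤
                (gameLaw F).real {ω | (robustFactor (α i) b - C * rate T) *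
                    idealUtility (F i) (α i) ≤ (1 / (T : ℝ)) * ∑ t, utility α T b π σ t ω})) := by
  have hα1 : α i ≤ 1 := by
    rw [← hsum]
    exact Finset.single_le_sum (fun j _ => (hα j).le) (Finset.mem_univ i)
  have hL : ∀ b : ℝ, 0 < b → 0 ≤ lossConstant n (α i) b := fun b hb =>
    lossConstant_nonneg (hα i) hα1 hb
  -- In the third constant the `3` counts the three deviation events of probability at most `T⁻²`
  -- each; the other entry of the maximum is the loss in the factor.
  refine ⟨⟨lossConstant n (α i) (8 / 3) + 2, by linarith [hL (8 / 3) (by norm_num)], ?_⟩,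
    fun b hb => ⟨⟨lossConstant n (α i) b + 2, by linarith [hL b (by linarith)], ?_⟩,
      fun μ => ⟨max 3 (lossConstant n (α i) b + 2 / idealUtility μ (α i)), by positivity, ?_⟩⟩⟩
  · rintro F _ hF T hT _ ⟨ρ, hρ, rfl⟩
    exact (isRobust_quantileStrategy hα hsum hα1 (by norm_num) (hF i) hT hρ).mono
      (sub_le_sub_right (five_eighths_le_robustFactor (hα i).le hα1) _)
      (idealUtility_mem (hF i) hρ).1
  · rintro F _ hF T hT _ ⟨ρ, hρ, rfl⟩
    exact isRobust_quantileStrategy hα hsum hα1 (by linarith) (hF i) hT hρ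
  · rintro F _ hF rfl T hT _ ⟨ρ, hρ, rfl⟩ σ hσ
    refine le_trans ?_ (measureReal_utility_ge hα hsum hα1 (by linarith) (hF i) hT hρ hσ
      (le_max_right 3 _))
    refine sub_le_sub_left ?_ _
    gcongr
    exact le_max_left _ _
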